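/- Identify $S^1\simeq\mathbb R/2\pi\mathbb Z$ with arc length measure $dx$, the distance $|x-y|=2|\sin\frac{x-y}{2}|$ and the balls $B_r(x_0)=\{x\in S^1:|x-x_0|<r\}$. For $0<s<1$ let $(-\Delta)^s$ be the Fourier multiplier $\widehat{(-\Delta)^sf}(k)=|k|^{2s}\hat f(k)$, $k\in\mathbb Z$, acting componentwise on $\mathbb R^n$-valued functions on $S^1$ (and, for functions of $(t,x)$, on the variable $x$). There is a constant $C>0$ (not depending on $R,u,T$, nor on $n$ or $x_0$) such that for every $n\ge 1$, every $T>0$, every $0<R<1$ and every $u:[0,T]\times S^1\to\mathbb R^n$ that is smooth on $[0,T]\times S^1$, the following holds. For all $x_0\in S^1$ $$\int_0^T\!\!\int_{B_{3R/4}(x_0)}|(-\Delta)^{1/4}u|^4\,dx\,dt\le C\sup_{0\le t\le T}\int_{B_R(x_0)}|(-\Delta)^{1/4}u(t)|^2dx\cdot\Big(\int_0^T\!\!\int_{B_R(x_0)}|(-\Delta)^{1/2}u|^2dx\,dt+\frac1{R^2}\int_0^T\!\!\int_{S^1}|(-\Delta)^{1/4}u|^2dx\,dt\Big),$$ and $$\int_0^T\!\!\int_{S^1}|(-\Delta)^{1/4}u|^4\,dx\,dt\le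 C\sup_{0\le t\le T,\;x\in S^1}\int_{B_R(x)}|(-\Delta)^{1/4}u(t)|^2dx\cdot\Big(\int_0^T\!\!\int_{S^1}|(-\Delta)^{1/2}u|^2dx\,dt+\frac1{R^3}\int_0^T\!\!\int_{S^1}|(-\Delta)^{1/4}u|^2dx\,dt\Big).$$ Both estimates also hold, with the same $C$ and with the supremum over $t$ read as an essential supremum, for all $u\in H^1([0,T]\times S^1;\mathbb R^n)$ with bounded half-Dirichlet energy, that is, $\operatorname{ess\,sup}_{0\le t\le T}\frac12\int_{S^1}|(-\Delta)^{1/4}u(t)|^2dx<\infty$. -/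

import Mathlib

open MeasureTheory Set
open scoped ENNReal NNReal ContDiff

noncomputable section

namespace HalfHarmonic

/-- The length `2π` of the circle is positive. -/
instance factTwoPiPos : Fact (0 < 2 * Real.pi) := ⟨Real.two_pi_pos⟩

/-- The circle `S¹ ≃ ℝ / 2πℤ`; its `volume` is the arc length measure `dx`, of total mass `2π`. -/
abbrev S1 : Type := AddCircle (2 * Real.pi)

/-- The chordal distance `|x - y| = |e^{ix} - e^{iy}|` on the circle. -/
def chord (x y : S1) : ℝ := ‖(AddCircle.toCircle x : ℂ) - (AddCircle.toCircle y : ℂ)‖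

/-- The chordal distance is `2 |sin ((x - y) / 2)|`. -/
theorem chord_coe (x y : ℝ) :
    chord (x : S1) (y : S1) = 2 * |Real.sin ((x - y) / 2)| := by
  have hx : ∀ z : ℝ, ((AddCircle.toCircle (z : S1) : Circle) : ℂ)
      = Complex.exp ((z : ℂ) * Complex.I) := by
    intro z
    rw [AddCircle.toCircle_apply_mk, Circle.coe_exp]
    congr 2
    have : (2 * Real.pi) / (2 * Real.pi) * z = z := by
      rw [div_self Real.two_pi_pos.ne', one_mul]
    rw [this]
  have key : Complex.exp ((x : ℂ) * Complex.I) - Complex.exp ((y : ℂ) * Complex.I)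
      = Complex.exp ((y : ℂ) * Complex.I) * (Complex.exp (Complex.I * ((x - y : ℝ) : ℂ)) - 1) := by
    rw [mul_sub, ← Complex.exp_add, mul_one]
    congr 2
    push_cast
    ring
  rw [chord, hx, hx, key, norm_mul, Complex.norm_exp_ofReal_mul_I, one_mul,
    Complex.norm_exp_I_mul_ofReal_sub_one, norm_mul, Real.norm_eq_abs, Real.norm_eq_abs,
    abs_of_pos (by norm_num : (0 : ℝ) < 2)]

/-- The ball of centre `x₀` and radius `r` in the circle, for the chordal distance. -/
def ball (x₀ : S1) (r : ℝ) : Set S1 := {x | chord x x₀ < r}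

open scoped Classical in
/-- The fractional Laplacian `(-Δ)^s f` of a scalar function on the circle, with
`L²` values: the element of `L²(S¹)` with Fourier coefficients `|k|^{2s} f̂(k)`, `k ∈ ℤ`, where
`f̂(k) = (2π)⁻¹ ∫ f(x) e^{-ikx} dx`. It is set to zero if there is no such element. -/
def scalarFracLaplacian (s : ℝ) (f : S1 → ℂ) :
    Lp ℂ 2 (AddCircle.haarAddCircle (T := 2 * Real.pi)) :=
  if h : Memℓp (fun k : ℤ => (((|(k : ℝ)| ^ (2 * s) : ℝ) : ℂ) * fourierCoeff f k)) 2 then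
    fourierBasis.repr.symm ⟨_, h⟩
  else 0

/-- The defining property of the fractional Laplacian as a Fourier multiplier. -/
theorem fourierCoeff_scalarFracLaplacian (s : ℝ) (f : S1 → ℂ)
    (h : Memℓp (fun k : ℤ => (((|(k : ℝ)| ^ (2 * s) : ℝ) : ℂ) * fourierCoeff f k)) 2) (k : ℤ) :
    fourierCoeff (scalarFracLaplacian s f) k
      = ((|(k : ℝ)| ^ (2 * s) : ℝ) : ℂ) * fourierCoeff f k := by
  rw [← fourierBasis_repr, scalarFracLaplacian, dif_pos h, LinearIsometryEquiv.apply_symm_apply]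

/-- The fractional Laplacian `(-Δ)^s f` of an `ℝⁿ`-valued function on the circle, taken
componentwise. Its values are recorded in `ℂⁿ ⊇ ℝⁿ`, with the Euclidean norm. -/
def fracLaplacian {n : ℕ} (s : ℝ) (f : S1 → EuclideanSpace ℝ (Fin n)) (x : S1) :
    EuclideanSpace ℂ (Fin n) :=
  WithLp.toLp 2 fun i => scalarFracLaplacian s (fun y => ((f y i : ℝ) : ℂ)) x

/-- `w(t, x)` is smooth on the set `I × S¹`, up to the boundary of the interval `I`. -/
def SmoothOn {E : Type*} [NormedAddCommGroup E] [NormedSpace ℝ E]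
    (I : Set ℝ) (w : ℝ → S1 → E) : Prop :=
  ContDiffOn ℝ ∞ (fun p : ℝ × ℝ => w p.1 (p.2 : S1)) (I ×ˢ (univ : Set ℝ))

/-- The partial derivative in time of a function on `ℝ × S¹`. -/
def timeDeriv (φ : ℝ → S1 → ℝ) (t : ℝ) (x : S1) : ℝ := deriv (fun τ => φ τ x) t

/-- The partial derivative in space of a function on `ℝ × S¹`. -/
def spaceDeriv (φ : ℝ → S1 → ℝ) (t : ℝ) (x : S1) : ℝ :=
  deriv (fun h : ℝ => φ t (x + (h : S1))) 0

/-- Test functions: the smooth real functions on `ℝ × S¹` with compact support in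
`(0, T) × S¹`. -/
def IsTest (T : ℝ) (φ : ℝ → S1 → ℝ) : Prop :=
  SmoothOn univ φ ∧ ∃ a b : ℝ, 0 < a ∧ b < T ∧ ∀ t, t ∉ Icc a b → ∀ x, φ t x = 0

/-- The measure `dt dx` on `[0, T] × S¹`. -/
def cylinder (T : ℝ) : Measure (ℝ × S1) := (volume.restrict (Icc 0 T)).prod volume

/-- The Sobolev space `H¹([0, T] × S¹; ℝⁿ)`: the square integrable functions whose weak first
derivatives in time and in space are square integrable. -/
def MemH1 {n : ℕ} (T : ℝ) (u : ℝ → S1 → EuclideanSpace ℝ (Fin n)) : Prop :=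
  MemLp (fun p : ℝ × S1 => u p.1 p.2) 2 (cylinder T) ∧
  ∃ ut ux : ℝ × S1 → EuclideanSpace ℝ (Fin n),
    MemLp ut 2 (cylinder T) ∧ MemLp ux 2 (cylinder T) ∧
    ∀ φ : ℝ → S1 → ℝ, IsTest T φ →
      (∫ p, timeDeriv φ p.1 p.2 • u p.1 p.2 ∂cylinder T = -∫ p, φ p.1 p.2 • ut p ∂cylinder T) ∧
      (∫ p, spaceDeriv φ p.1 p.2 • u p.1 p.2 ∂cylinder T = -∫ p, φ p.1 p.2 • ux p ∂cylinder T)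

/-- The slice integral `∫_B |(-Δ)^s f|^m dx`, as a number in `[0, ∞]`. -/
def sliceInt {n : ℕ} (s : ℝ) (m : ℕ) (B : Set S1) (f : S1 → EuclideanSpace ℝ (Fin n)) : ℝ≥0∞ :=
  ∫⁻ x in B, ‖fracLaplacian s f x‖ₑ ^ m

/-- The space-time integral `∫₀ᵀ ∫_B |(-Δ)^s u|^m dx dt`, as a number in `[0, ∞]`. -/
def spaceTimeInt {n : ℕ} (s : ℝ) (m : ℕ) (T : ℝ) (B : Set S1)
    (u : ℝ → S1 → EuclideanSpace ℝ (Fin n)) : ℝ≥0∞ :=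
  ∫⁻ t in Icc 0 T, sliceInt s m B (u t)

/-- The half-Dirichlet energy `½ ∫ |(-Δ)^{1/4} f|² dx` over the circle. -/
def energy {n : ℕ} (f : S1 → EuclideanSpace ℝ (Fin n)) : ℝ≥0∞ := sliceInt (1 / 4) 2 univ f / 2

end HalfHarmonic

end

open HalfHarmonic

/-! On one time slice and for one component put `v = (-Δ)^{1/4} u` and `g = (-Δ)^{1/2} u`, so that
`ĝ(k) = √|k| v̂(k)`. The local estimate is the Gagliardo–Nirenberg inequality `‖w‖₄⁴ ≤ C ‖w‖₂²
‖w‖²_{H^{1/2}}` applied to `w = η v`, with `η` a cutoff of the ball of radius `R`.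

Gagliardo–Nirenberg (`lintegral_enorm_pow_four_le`) comes from the layer-cake formula with a
frequency splitting that depends on the height `t`: about `t² / ‖w‖₂²` low frequencies cannot exceed
`t / 2` pointwise, so the level set is controlled by the `L²` norm of the rest, and integrating in
`t` turns the threshold into the weight `|k|`.

The `H^{1/2}` norm of `η v` is compared with `‖η g‖₂` by a commutator bound
(`tsum_abs_mul_fourierCoeff_mul_le`). Since `|√|k| - √|k - m|| ≤ √|m|`, the commutator is dominated
by a convolution with `√|m| |η̂(m)|`, whose `ℓ¹` norm is `O(1/R)` for an explicit `C²` cutoff.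
Squaring gives the factor `1/R²`.

Components are summed with a constant independent of `n` (`lintegral_finset_sum_sq_le`). The global
estimate follows by averaging the local one over all centres: the local term `g` gains a factor `R`
that cancels the volume of the small ball, while the nonlocal term gains nothing, whence `1/R³`.
Finally the slice bounds are integrated in time. This needs only that almost every slice has Fourier
coefficients in the `H¹` class and that they are measurable in time (`HasRegularSlices`), which
holds both for smooth and for `H¹` functions. -/

noncomputable section

namespace HalfHarmonic

/-! ### Cauchy–Schwarz in `[0, ∞]`. -/

/-- The Cauchy–Schwarz inequality for lower integrals. -/
theorem sq_lintegral_mul_le {α : Type*} [MeasurableSpace α] (μ : Measure α) {f g : α → ℝ≥0∞}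
    (hf : AEMeasurable f μ) (hg : AEMeasurable g μ) :
    (∫⁻ a, f a * g a ∂μ) ^ 2 ≤ (∫⁻ a, f a ^ 2 ∂μ) * ∫⁻ a, g a ^ 2 ∂μ := by
  have h := ENNReal.lintegral_mul_le_Lp_mul_Lq μ Real.HolderConjugate.two_two hf hg
  simp only [Pi.mul_apply, ENNReal.rpow_two] at h
  refine (pow_le_pow_left' h 2).trans_eq ?_
  rw [mul_pow, ← ENNReal.rpow_natCast, ← ENNReal.rpow_natCast, ← ENNReal.rpow_mul,
    ← ENNReal.rpow_mul]
  norm_num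

/-- The Cauchy–Schwarz inequality for series over `ℤ`. -/
theorem sq_tsum_mul_le (f g : ℤ → ℝ≥0∞) :
    (∑' k, f k * g k) ^ 2 ≤ (∑' k, f k ^ 2) * ∑' k, g k ^ 2 := by
  have h := sq_lintegral_mul_le (Measure.count : Measure ℤ) (f := f) (g := g)
    (measurable_of_countable f).aemeasurable (measurable_of_countable g).aemeasurable
  simpa only [lintegral_count] using h

/-! ### Parseval and the Gagliardo–Nirenberg inequality on the circle. -/

section AddCircle

variable {T : ℝ} [hT : Fact (0 < T)]

/-- Parseval's identity in `[0, ∞]`. -/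
theorem lintegral_enorm_sq_eq_tsum {f : AddCircle T → ℂ}
    (hf : MemLp f 2 (AddCircle.haarAddCircle (T := T))) :
    ∫⁻ x, ‖f x‖ₑ ^ 2 ∂AddCircle.haarAddCircle (T := T) = ∑' k : ℤ, ‖fourierCoeff f k‖ₑ ^ 2 := by
  have h1 := hasSum_sq_fourierCoeff hf.toLp
  have h2 : fourierCoeff (hf.toLp : AddCircle T → ℂ) = fourierCoeff f :=
    fourierCoeff_congr_ae hf.coeFn_toLp
  rw [h2] at h1
  have h3 : ∫ t : AddCircle T, ‖(hf.toLp : AddCircle T → ℂ) t‖ ^ 2 ∂AddCircle.haarAddCircle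
      = ∫ t : AddCircle T, ‖f t‖ ^ 2 ∂AddCircle.haarAddCircle := by
    refine integral_congr_ae ?_
    filter_upwards [hf.coeFn_toLp] with x hx
    rw [hx]
  rw [h3] at h1
  have h4 : ∀ z : ℂ, ‖z‖ₑ ^ 2 = ENNReal.ofReal (‖z‖ ^ 2) := fun z => by
    rw [ENNReal.ofReal_pow (norm_nonneg _), ofReal_norm]
  simp_rw [h4]
  rw [← ENNReal.ofReal_tsum_of_nonneg (fun k => sq_nonneg _) h1.summable, h1.tsum_eq,
    ofReal_integral_eq_lintegral_ofReal]
  · exact (memLp_two_iff_integrable_sq_norm hf.1).1 hf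
  · exact Filter.Eventually.of_forall fun x => sq_nonneg _

/-- The Fourier partial sum over a finite set of frequencies. -/
def partialSum (f : AddCircle T → ℂ) (S : Finset ℤ) (x : AddCircle T) : ℂ :=
  ∑ k ∈ S, fourierCoeff f k * fourier k x

theorem continuous_partialSum (f : AddCircle T → ℂ) (S : Finset ℤ) :
    Continuous (partialSum f S) := by
  unfold partialSum
  fun_prop

theorem fourierCoeff_partialSum (f : AddCircle T → ℂ) (S : Finset ℤ) (k : ℤ) :
    fourierCoeff (partialSum f S) k = if k ∈ S then fourierCoeff f k else 0 := by
  have h : partialSum f S = ∑ l ∈ S, fun x => fourierCoeff f l * fourier l x := by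
    ext x; simp [partialSum]
  rw [h, fourierCoeff.sum]
  · simp only [Finset.sum_apply]
    simp_rw [fourierCoeff.const_mul, fourierCoeff_fourier]
    simp [Pi.single_apply]
  · intro l _
    exact Continuous.integrable_of_hasCompactSupport (by fun_prop)
      (HasCompactSupport.of_compactSpace _)

theorem memLp_partialSum (f : AddCircle T → ℂ) (S : Finset ℤ) (p : ℝ≥0∞) :
    MemLp (partialSum f S) p (AddCircle.haarAddCircle (T := T)) :=
  (continuous_partialSum f S).memLp_of_hasCompactSupport (HasCompactSupport.of_compactSpace _)

theorem fourierCoeff_sub_partialSum {f : AddCircle T → ℂ}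
    (hf : MemLp f 2 (AddCircle.haarAddCircle (T := T))) (S : Finset ℤ) (k : ℤ) :
    fourierCoeff (fun x => f x - partialSum f S x) k = if k ∈ S then 0 else fourierCoeff f k := by
  have h : (fun x => f x - partialSum f S x) = f + (-1 : ℂ) • partialSum f S := by
    ext x; simp [sub_eq_add_neg]
  rw [h, fourierCoeff.add (hf.integrable (by norm_num))
    (((memLp_partialSum f S 2).integrable (by norm_num)).smul _)]
  simp only [Pi.add_apply, fourierCoeff.const_smul, fourierCoeff_partialSum]
  split_ifs <;> simp

/-- Characters are unimodular, so Cauchy–Schwarz over the frequencies costs only their number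
(Bernstein's inequality). -/
theorem norm_partialSum_sq_le (f : AddCircle T → ℂ) (S : Finset ℤ) (x : AddCircle T) :
    ‖partialSum f S x‖ ^ 2 ≤ S.card * ∑ k ∈ S, ‖fourierCoeff f k‖ ^ 2 := by
  have h1 : ‖partialSum f S x‖ ≤ ∑ k ∈ S, ‖fourierCoeff f k‖ := by
    refine (norm_sum_le _ _).trans (Finset.sum_le_sum fun k _ => ?_)
    rw [norm_mul, fourier_apply, Circle.norm_coe, mul_one]
  exact (pow_le_pow_left₀ (norm_nonneg _) h1 2).trans sq_sum_le_card_mul_sum_sq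

/-- The frequencies `k` with `2 |k| + 1 ≤ M`. -/
def lowFreq (M : ℝ) : Finset ℤ :=
  if M < 1 then ∅ else Finset.Icc (-(⌊(M - 1) / 2⌋₊ : ℤ)) (⌊(M - 1) / 2⌋₊ : ℤ)

theorem mem_lowFreq {M : ℝ} {k : ℤ} : k ∈ lowFreq M ↔ 2 * |(k : ℝ)| + 1 ≤ M := by
  unfold lowFreq
  split_ifs with h
  · simp only [Finset.notMem_empty, false_iff, not_le]
    have := abs_nonneg (k : ℝ)
    linarith
  · rw [Finset.mem_Icc, ← abs_le, Int.abs_eq_natAbs, Nat.cast_le, Nat.le_floor_iff (by linarith),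
      ← Int.cast_abs, Int.abs_eq_natAbs, Int.cast_natCast, le_div_iff₀ (by norm_num)]
    constructor <;> intro h <;> linarith

/-- The weight `2 |k| + 1` counts the integers of absolute value at most `|k|`, so cutting at weight
`M` keeps at most `M` frequencies. -/
theorem card_lowFreq_le {M : ℝ} (hM : 0 ≤ M) : ((lowFreq M).card : ℝ) ≤ M := by
  unfold lowFreq
  split_ifs with h
  · simpa using hM
  · have h1 : ((⌊(M - 1) / 2⌋₊ : ℕ) : ℝ) ≤ (M - 1) / 2 := Nat.floor_le (by linarith)
    rw [Int.card_Icc]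
    have : ((⌊(M - 1) / 2⌋₊ : ℤ) + 1 - -(⌊(M - 1) / 2⌋₊ : ℤ)).toNat
      = 2 * ⌊(M - 1) / 2⌋₊ + 1 := by omega
    rw [this]
    push_cast
    linarith

/-- Chebyshev's inequality for the high frequencies of a square integrable function. -/
theorem measure_lt_norm_le {f : AddCircle T → ℂ}
    (hf : MemLp f 2 (AddCircle.haarAddCircle (T := T))) {X : ℝ} (hX : 0 < X)
    (hfX : ∑' k : ℤ, ‖fourierCoeff f k‖ₑ ^ 2 ≤ ENNReal.ofReal X) {t : ℝ} (ht : 0 < t) :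
    AddCircle.haarAddCircle {x : AddCircle T | t < ‖f x‖} ≤
      ENNReal.ofReal (4 / t ^ 2) *
        ∑' k : ℤ, if t ^ 2 < 4 * X * (2 * |(k : ℝ)| + 1) then ‖fourierCoeff f k‖ₑ ^ 2 else 0 := by
  -- This size makes the Bernstein bound `card * X` equal to at most `(t / 2)²`, so where `t < ‖f‖`
  -- the high-frequency remainder is at least `t / 2`.
  set S := lowFreq (t ^ 2 / (4 * X))
  have hS : ∀ k, k ∈ S ↔ ¬ t ^ 2 < 4 * X * (2 * |(k : ℝ)| + 1) := fun k => by
    rw [mem_lowFreq, le_div_iff₀ (by positivity), not_lt, mul_comm]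
  have hlow : ∀ x, ‖partialSum f S x‖ ≤ t / 2 := fun x => by
    have h1 := norm_partialSum_sq_le f S x
    have h2 : ∑ k ∈ S, ‖fourierCoeff f k‖ ^ 2 ≤ X := by
      rw [← ENNReal.ofReal_le_ofReal_iff hX.le, ENNReal.ofReal_sum_of_nonneg fun k _ => sq_nonneg _]
      refine (Finset.sum_le_sum fun k _ => ?_).trans ((ENNReal.sum_le_tsum S).trans hfX)
      rw [ENNReal.ofReal_pow (norm_nonneg _), ofReal_norm]
    have h3 : ((S.card : ℕ) : ℝ) ≤ t ^ 2 / (4 * X) := card_lowFreq_le (by positivity)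
    refine le_of_sq_le_sq ?_ (by positivity)
    calc _ ≤ _ := h1
      _ ≤ t ^ 2 / (4 * X) * X := by gcongr
      _ = (t / 2) ^ 2 := by field_simp; norm_num
  have hr : MemLp (fun x => f x - partialSum f S x) 2 (AddCircle.haarAddCircle (T := T)) :=
    hf.sub (memLp_partialSum f S 2)
  have hsub : {x : AddCircle T | t < ‖f x‖} ⊆
      {x | ENNReal.ofReal (t ^ 2 / 4) ≤ ‖f x - partialSum f S x‖ₑ ^ 2} := fun x hx => by
    simp only [mem_ofPred_eq] at hx ⊢
    have h1 := norm_sub_norm_le (f x) (partialSum f S x)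
    have h2 := hlow x
    rw [← ofReal_norm, ← ENNReal.ofReal_pow (norm_nonneg _)]
    refine ENNReal.ofReal_le_ofReal ?_
    have h3 : t / 2 ≤ ‖f x - partialSum f S x‖ := by linarith
    calc t ^ 2 / 4 = (t / 2) ^ 2 := by ring
      _ ≤ _ := by gcongr
  refine (measure_mono hsub).trans ((meas_ge_le_lintegral_div (hr.1.enorm.pow_const 2)
    (by positivity) ENNReal.ofReal_ne_top).trans_eq ?_)
  rw [lintegral_enorm_sq_eq_tsum hr, div_eq_mul_inv, mul_comm,
    ← ENNReal.ofReal_inv_of_pos (by positivity), inv_div]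
  congr 1
  refine tsum_congr fun k => ?_
  rw [fourierCoeff_sub_partialSum hf]
  by_cases h : k ∈ S
  · simp [h, (hS k).1 h]
  · simp [h, not_not.1 (mt (hS k).2 h)]

/-- The layer-cake weight `t³` times the Chebyshev factor `t⁻²` leaves `t dt`. A frequency
contributes only below a height whose square is linear in `|k|`, and this integral produces the
`H^{1/2}` weight. -/
theorem lintegral_Ioi_ite_sq_lt (a : ℝ) (ha : 0 ≤ a) :
    ∫⁻ t in Ioi (0 : ℝ), (if t ^ 2 < a then ENNReal.ofReal t else 0) ≤ ENNReal.ofReal (a / 2) := by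
  have h1 : ∀ t ∈ Ioi (0 : ℝ), (if t ^ 2 < a then ENNReal.ofReal t else 0)
      ≤ (Ioc 0 (√a)).indicator (fun t => ENNReal.ofReal t) t := fun t ht => by
    split_ifs with h
    · rw [indicator_of_mem]
      exact ⟨ht, Real.le_sqrt_of_sq_le h.le⟩
    · exact zero_le
  refine (setLIntegral_mono' measurableSet_Ioi h1).trans ?_
  refine (setLIntegral_le_lintegral _ _).trans ?_
  rw [lintegral_indicator measurableSet_Ioc, ← ofReal_integral_eq_lintegral_ofReal]
  · rw [← intervalIntegral.integral_of_le (Real.sqrt_nonneg _), integral_id]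
    simp [Real.sq_sqrt ha]
  · exact (continuous_id.integrableOn_Icc (a := 0) (b := √a)).mono_set Ioc_subset_Icc_self
  · exact (ae_restrict_iff' measurableSet_Ioc).2 (Filter.Eventually.of_forall fun t ht => ht.1.le)

/-- The Gagliardo–Nirenberg inequality `‖f‖₄⁴ ≤ C ‖f‖₂² ‖f‖²_{H^{1/2}}` on the circle. -/
theorem lintegral_enorm_pow_four_le {f : AddCircle T → ℂ}
    (hf : MemLp f 2 (AddCircle.haarAddCircle (T := T))) :
    ∫⁻ x, ‖f x‖ₑ ^ 4 ∂AddCircle.haarAddCircle (T := T) ≤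
      32 * (∑' k : ℤ, ‖fourierCoeff f k‖ₑ ^ 2) *
        ∑' k : ℤ, ENNReal.ofReal (2 * |(k : ℝ)| + 1) * ‖fourierCoeff f k‖ₑ ^ 2 := by
  have hfin : ∫⁻ x, ‖f x‖ₑ ^ 2 ∂AddCircle.haarAddCircle (T := T) ≠ ⊤ := by
    have := hf.eLpNorm_lt_top
    rw [eLpNorm_lt_top_iff_lintegral_rpow_enorm_lt_top two_ne_zero ENNReal.ofNat_ne_top] at this
    simpa using this.ne
  have hpars := lintegral_enorm_sq_eq_tsum hf
  -- The threshold divides by the squared `L²` norm, so `f = 0` almost everywhere is treated apart.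
  rcases eq_or_ne (∑' k : ℤ, ‖fourierCoeff f k‖ₑ ^ 2) 0 with h0 | h0
  · rw [h0] at hpars ⊢
    rw [lintegral_eq_zero_iff' (hf.1.enorm.pow_const 2)] at hpars
    rw [mul_zero, zero_mul, nonpos_iff_eq_zero, lintegral_eq_zero_iff' (hf.1.enorm.pow_const 4)]
    filter_upwards [hpars] with x hx
    simpa using hx
  rw [hpars] at hfin
  obtain ⟨X, hX, hfX⟩ : ∃ X : ℝ, 0 < X ∧ ∑' k : ℤ, ‖fourierCoeff f k‖ₑ ^ 2 = ENNReal.ofReal X :=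
    ⟨_, ENNReal.toReal_pos h0 hfin, (ENNReal.ofReal_toReal hfin).symm⟩
  have hcake := lintegral_rpow_eq_lintegral_meas_lt_mul (AddCircle.haarAddCircle (T := T))
    (f := fun x => ‖f x‖) (Filter.Eventually.of_forall fun x => norm_nonneg _) hf.1.norm.aemeasurable
    (p := 4) (by norm_num)
  have hleft : ∀ x, ‖f x‖ₑ ^ 4 = ENNReal.ofReal (‖f x‖ ^ (4 : ℝ)) := fun x => by
    rw [← ofReal_norm, ← ENNReal.ofReal_pow (norm_nonneg _)]
    norm_cast
  simp_rw [hleft]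
  rw [hcake]
  have hbound : ∀ t ∈ Ioi (0 : ℝ), AddCircle.haarAddCircle {x : AddCircle T | t < ‖f x‖} *
      ENNReal.ofReal (t ^ ((4 : ℝ) - 1)) ≤ ∑' k : ℤ, 4 * ‖fourierCoeff f k‖ₑ ^ 2 *
        (if t ^ 2 < 4 * X * (2 * |(k : ℝ)| + 1) then ENNReal.ofReal t else 0) := fun t ht => by
    have ht' : (0 : ℝ) < t := ht
    have hpow : ENNReal.ofReal (t ^ ((4 : ℝ) - 1)) = ENNReal.ofReal (t ^ 3) := by
      norm_num
    rw [hpow]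
    refine (mul_le_mul_left (measure_lt_norm_le hf hX hfX.le ht) _).trans_eq ?_
    rw [mul_right_comm, ← ENNReal.ofReal_mul (by positivity), ← ENNReal.tsum_mul_left]
    refine tsum_congr fun k => ?_
    have h4 : ENNReal.ofReal (4 / t ^ 2 * t ^ 3) = 4 * ENNReal.ofReal t := by
      rw [show 4 / t ^ 2 * t ^ 3 = 4 * t by field_simp, ENNReal.ofReal_mul (by norm_num)]
      simp
    rw [h4]
    split_ifs <;> ring
  calc _ ≤ ENNReal.ofReal 4 * ∫⁻ t in Ioi (0 : ℝ), ∑' k : ℤ, 4 * ‖fourierCoeff f k‖ₑ ^ 2 *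
        (if t ^ 2 < 4 * X * (2 * |(k : ℝ)| + 1) then ENNReal.ofReal t else 0) := by
        exact mul_le_mul_right (setLIntegral_mono' measurableSet_Ioi hbound) _
    _ = ENNReal.ofReal 4 * ∑' k : ℤ, 4 * ‖fourierCoeff f k‖ₑ ^ 2 * ∫⁻ t in Ioi (0 : ℝ),
        (if t ^ 2 < 4 * X * (2 * |(k : ℝ)| + 1) then ENNReal.ofReal t else 0) := by
        have hm : ∀ k : ℤ, Measurable fun t : ℝ =>
            if t ^ 2 < 4 * X * (2 * |(k : ℝ)| + 1) then ENNReal.ofReal t else 0 := fun k =>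
          Measurable.ite (measurableSet_lt (by fun_prop) measurable_const) (by fun_prop)
            measurable_const
        rw [lintegral_tsum fun k => ((hm k).const_mul _).aemeasurable]
        congr 1
        exact tsum_congr fun k => lintegral_const_mul _ (hm k)
    -- The constant 32 is 4 (the exponent, from the layer cake), times 4 (Chebyshev at `t / 2`),
    -- times 2 (from `4 X / 2`).
    _ ≤ ENNReal.ofReal 4 * ∑' k : ℤ, 4 * ‖fourierCoeff f k‖ₑ ^ 2 *
        ENNReal.ofReal (4 * X * (2 * |(k : ℝ)| + 1) / 2) := by
        gcongr with k
        exact lintegral_Ioi_ite_sq_lt _ (by positivity)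
    _ = _ := by
        rw [hfX, ← ENNReal.tsum_mul_left, ← ENNReal.tsum_mul_left]
        refine tsum_congr fun k => ?_
        rw [show 4 * X * (2 * |(k : ℝ)| + 1) / 2 = 2 * X * (2 * |(k : ℝ)| + 1) by ring,
          ENNReal.ofReal_mul (by positivity), ENNReal.ofReal_mul (by positivity)]
        simp only [ENNReal.ofReal_ofNat]
        ring

end AddCircle

/-! ### Convolution bounds and the commutator with a multiplication. -/

theorem add_sq_le_two_mul_add (a b : ℝ≥0∞) : (a + b) ^ 2 ≤ 2 * a ^ 2 + 2 * b ^ 2 := by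
  have h := ENNReal.rpow_add_le_mul_rpow_add_rpow a b (p := 2) (by norm_num)
  norm_num at h
  rwa [mul_add] at h

/-- Young's inequality `ℓ¹ * ℓ² ⊆ ℓ²`. -/
theorem tsum_sq_conv_le (b c : ℤ → ℝ≥0∞) :
    ∑' k, (∑' m, b m * c (k - m)) ^ 2 ≤ (∑' m, b m) ^ 2 * ∑' k, c k ^ 2 := by
  have hb : ∀ m, (b m ^ (1 / 2 : ℝ)) ^ 2 = b m := fun m => by
    rw [← ENNReal.rpow_natCast, ← ENNReal.rpow_mul]; norm_num
  have h1 : ∀ k, (∑' m, b m * c (k - m)) ^ 2 ≤ (∑' m, b m) * ∑' m, b m * c (k - m) ^ 2 := by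
    intro k
    -- Splitting `b = b^{1/2} b^{1/2}` makes Cauchy–Schwarz act with `b` as a measure.
    have h := sq_tsum_mul_le (fun m => b m ^ (1 / 2 : ℝ)) (fun m => b m ^ (1 / 2 : ℝ) * c (k - m))
    simp_rw [← mul_assoc, ← sq, mul_pow, hb] at h
    exact h
  calc _ ≤ ∑' k, (∑' m, b m) * ∑' m, b m * c (k - m) ^ 2 := ENNReal.tsum_le_tsum h1
    _ = (∑' m, b m) * ∑' m, b m * ∑' k, c (k - m) ^ 2 := by
      rw [ENNReal.tsum_mul_left, ENNReal.tsum_comm]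
      simp_rw [ENNReal.tsum_mul_left]
    _ = _ := by
      have : ∀ m : ℤ, ∑' k, c (k - m) ^ 2 = ∑' k, c k ^ 2 := fun m =>
        (Equiv.subRight m).tsum_eq fun k => c k ^ 2
      simp_rw [this, ENNReal.tsum_mul_right]
      ring

/-- Subadditivity of the square root. It moves the half derivative of the commutator entirely onto
the cutoff. -/
theorem abs_sqrt_abs_sub_sqrt_abs_le (a b : ℝ) : |(√|a|) - (√|b|)| ≤ √|a - b| := by
  have key : ∀ a b : ℝ, √|a| ≤ √|b| + √|a - b| := fun a b => by
    have h := abs_add_le b (a - b)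
    rw [add_sub_cancel] at h
    rw [Real.sqrt_le_left (by positivity), add_sq, Real.sq_sqrt (abs_nonneg _),
      Real.sq_sqrt (abs_nonneg _)]
    have : 0 ≤ 2 * √|b| * √|a - b| := by positivity
    linarith
  rw [abs_le]
  have h1 := key a b
  have h2 := key b a
  rw [abs_sub_comm b a] at h2
  constructor <;> linarith

section AddCircle

variable {T : ℝ} [hT : Fact (0 < T)]

theorem fourierCoeff_const_mul_fourier_mul (v : AddCircle T → ℂ) (c : ℂ) (m k : ℤ) :
    fourierCoeff (fun x => c * fourier m x * v x) k = c * fourierCoeff v (k - m) := by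
  simp only [fourierCoeff, smul_eq_mul]
  rw [← integral_const_mul]
  congr 1
  ext x
  rw [show -(k - m) = -k + m by ring, fourier_add]
  ring

/-- The Fourier coefficients of a product are the convolution of the Fourier coefficients. -/
theorem hasSum_fourierCoeff_mul {η : C(AddCircle T, ℂ)} (hη : Summable (fourierCoeff η))
    {v : AddCircle T → ℂ} (hv : Integrable v (AddCircle.haarAddCircle (T := T))) (k : ℤ) :
    HasSum (fun m => fourierCoeff η m * fourierCoeff v (k - m))
      (fourierCoeff (fun x => η x * v x) k) := by
  have hint : ∀ m : ℤ, Integrable (fun x : AddCircle T =>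
      fourier (-k) x • (fourierCoeff η m * fourier m x * v x)) AddCircle.haarAddCircle := fun m => by
    refine Integrable.fourier_smul ?_ _
    simp_rw [mul_assoc]
    exact (Integrable.fourier_smul hv m).const_mul _
  have hnorm : ∀ (m : ℤ) (x : AddCircle T),
      ‖fourier (-k) x • (fourierCoeff η m * fourier m x * v x)‖ = ‖fourierCoeff η m‖ * ‖v x‖ := by
    intro m x
    rw [norm_smul, norm_mul, norm_mul, fourier_apply, fourier_apply, Circle.norm_coe,
      Circle.norm_coe, one_mul, mul_one]
  have h := hasSum_integral_of_summable_integral_norm hint (by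
    simp_rw [hnorm, integral_const_mul]
    exact hη.norm.mul_right _)
  have h1 : ∀ m : ℤ, ∫ x : AddCircle T, fourier (-k) x • (fourierCoeff η m * fourier m x * v x)
      ∂AddCircle.haarAddCircle = fourierCoeff η m * fourierCoeff v (k - m) := fun m =>
    fourierCoeff_const_mul_fourier_mul v _ m k
  suffices hL : (∫ x : AddCircle T, ∑' m : ℤ, fourier (-k) x • (fourierCoeff η m * fourier m x * v x)
      ∂AddCircle.haarAddCircle) = fourierCoeff (fun x => η x * v x) k by
    rw [← hL]
    exact (funext h1 : (fun m : ℤ => _) = _) ▸ h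
  rw [fourierCoeff]
  congr 1
  ext x
  have h2 := has_pointwise_sum_fourier_series_of_summable hη x
  have h3 := (h2.mul_right (v x)).const_smul (fourier (-k) x : ℂ)
  simp only [smul_eq_mul] at h3 ⊢
  exact h3.tsum_eq

/-- The commutator of `(-Δ)^{1/4}` with the multiplication by `η`, on the Fourier side. -/
theorem enorm_sqrt_mul_fourierCoeff_mul_le {η : C(AddCircle T, ℂ)}
    (hη : Summable (fourierCoeff η)) {v g : AddCircle T → ℂ}
    (hv : Integrable v (AddCircle.haarAddCircle (T := T)))
    (hg : Integrable g (AddCircle.haarAddCircle (T := T)))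
    (hvg : ∀ k : ℤ, fourierCoeff g k = (√|(k : ℝ)| : ℝ) * fourierCoeff v k) (k : ℤ) :
    ‖((√|(k : ℝ)| : ℝ) : ℂ) * fourierCoeff (fun x => η x * v x) k‖ₑ ≤
      ‖fourierCoeff (fun x => η x * g x) k‖ₑ +
        ∑' m : ℤ, ENNReal.ofReal (√|(m : ℝ)|) * ‖fourierCoeff η m‖ₑ * ‖fourierCoeff v (k - m)‖ₑ := by
  have h1 := (hasSum_fourierCoeff_mul hη hv k).mul_left ((√|(k : ℝ)| : ℝ) : ℂ)
  have h2 := hasSum_fourierCoeff_mul hη hg k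
  have h3 := h1.sub h2
  have h4 : ‖((√|(k : ℝ)| : ℝ) : ℂ) * fourierCoeff (fun x => η x * v x) k
      - fourierCoeff (fun x => η x * g x) k‖ₑ ≤ ∑' m : ℤ, ENNReal.ofReal (√|(m : ℝ)|) *
        ‖fourierCoeff η m‖ₑ * ‖fourierCoeff v (k - m)‖ₑ := by
    rw [← h3.tsum_eq]
    refine enorm_tsum_le_tsum_enorm.trans (ENNReal.tsum_le_tsum fun m => ?_)
    rw [hvg, show ((√|(k : ℝ)| : ℝ) : ℂ) * (fourierCoeff η m * fourierCoeff v (k - m)) -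
        fourierCoeff η m * ((√|((k - m : ℤ) : ℝ)| : ℝ) * fourierCoeff v (k - m)) =
        ((√|(k : ℝ)| - √|((k - m : ℤ) : ℝ)| : ℝ) : ℂ) * fourierCoeff η m * fourierCoeff v (k - m) by
          push_cast; ring, enorm_mul, enorm_mul]
    gcongr
    rw [← ofReal_norm, Complex.norm_real, Real.norm_eq_abs]
    refine ENNReal.ofReal_le_ofReal ?_
    have h5 := abs_sqrt_abs_sub_sqrt_abs_le (k : ℝ) ((k - m : ℤ) : ℝ)
    push_cast at h5 ⊢
    simpa using h5
  calc _ = ‖fourierCoeff (fun x => η x * g x) k + (((√|(k : ℝ)| : ℝ) : ℂ) *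
        fourierCoeff (fun x => η x * v x) k - fourierCoeff (fun x => η x * g x) k)‖ₑ := by
        congr 1; ring
    _ ≤ _ := (enorm_add_le _ _).trans (by gcongr)

/-- The `H^{1/2}` energy of `η v` is controlled by `η (-Δ)^{1/4} v` and `v` in `L²`. -/
theorem tsum_abs_mul_fourierCoeff_mul_le {η : C(AddCircle T, ℂ)}
    (hη : Summable (fourierCoeff η)) {v g : AddCircle T → ℂ}
    (hv : Integrable v (AddCircle.haarAddCircle (T := T)))
    (hg : Integrable g (AddCircle.haarAddCircle (T := T)))
    (hvg : ∀ k : ℤ, fourierCoeff g k = (√|(k : ℝ)| : ℝ) * fourierCoeff v k) :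
    ∑' k : ℤ, ENNReal.ofReal |(k : ℝ)| * ‖fourierCoeff (fun x => η x * v x) k‖ₑ ^ 2 ≤
      2 * ∑' k : ℤ, ‖fourierCoeff (fun x => η x * g x) k‖ₑ ^ 2 +
        2 * (∑' m : ℤ, ENNReal.ofReal (√|(m : ℝ)|) * ‖fourierCoeff η m‖ₑ) ^ 2 *
          ∑' k : ℤ, ‖fourierCoeff v k‖ₑ ^ 2 := by
  have h1 : ∀ k : ℤ, ENNReal.ofReal |(k : ℝ)| * ‖fourierCoeff (fun x => η x * v x) k‖ₑ ^ 2 ≤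
      2 * ‖fourierCoeff (fun x => η x * g x) k‖ₑ ^ 2 + 2 * (∑' m : ℤ, ENNReal.ofReal (√|(m : ℝ)|) *
        ‖fourierCoeff η m‖ₑ * ‖fourierCoeff v (k - m)‖ₑ) ^ 2 := fun k => by
    refine le_trans (le_of_eq ?_) ((pow_le_pow_left' (enorm_sqrt_mul_fourierCoeff_mul_le hη hv hg
      hvg k) 2).trans (add_sq_le_two_mul_add _ _))
    rw [enorm_mul, mul_pow, ← ofReal_norm ((√|(k : ℝ)| : ℝ) : ℂ), Complex.norm_real,
      Real.norm_eq_abs, ← ENNReal.ofReal_pow (abs_nonneg _), sq_abs, Real.sq_sqrt (abs_nonneg _)]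
  refine (ENNReal.tsum_le_tsum h1).trans ?_
  rw [ENNReal.tsum_add, ENNReal.tsum_mul_left, ENNReal.tsum_mul_left, mul_assoc]
  gcongr
  exact tsum_sq_conv_le (fun m : ℤ => ENNReal.ofReal (√|(m : ℝ)|) * ‖fourierCoeff η m‖ₑ)
    fun k => ‖fourierCoeff v k‖ₑ

end AddCircle

/-! ### Chordal balls and arc length. -/

theorem chord_comm (x y : S1) : chord x y = chord y x := norm_sub_rev _ _

theorem chord_nonneg (x y : S1) : 0 ≤ chord x y := norm_nonneg _

theorem continuous_chord : Continuous fun p : S1 × S1 => chord p.1 p.2 := by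
  have h : Continuous (AddCircle.toCircle : S1 → Circle) := AddCircle.continuous_toCircle
  unfold chord
  fun_prop

theorem sq_chord_coe (x y : ℝ) : chord (x : S1) (y : S1) ^ 2 = 2 - 2 * Real.cos (x - y) := by
  rw [chord_coe, mul_pow, sq_abs, Real.sin_sq_eq_half_sub, show 2 * ((x - y) / 2) = x - y by ring]
  ring

theorem measurableSet_ball (x₀ : S1) (r : ℝ) : MeasurableSet (ball x₀ r) :=
  (isOpen_lt (continuous_chord.comp (by fun_prop : Continuous fun x : S1 => (x, x₀)))
    continuous_const).measurableSet

theorem volume_eq_volume_preimage_inter_Ioc {s : Set S1} (hs : MeasurableSet s) (a : ℝ) :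
    volume s = volume ((fun y : ℝ => (y : S1)) ⁻¹' s ∩ Ioc a (a + 2 * Real.pi)) := by
  have h := (AddCircle.measurePreserving_mk (2 * Real.pi) a).measure_preimage hs.nullMeasurableSet
  rw [Measure.restrict_apply' measurableSet_Ioc] at h
  exact h.symm

theorem volume_ball_le (x₀ : S1) {r : ℝ} (hr : 0 ≤ r) :
    volume (ball x₀ r) ≤ ENNReal.ofReal (Real.pi * r) := by
  induction x₀ using QuotientAddGroup.induction_on with | H y₀ => ?_
  rw [volume_eq_volume_preimage_inter_Ioc (measurableSet_ball _ _) (y₀ - Real.pi)]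
  have hpi := Real.pi_pos
  have h : (fun y : ℝ => (y : S1)) ⁻¹' ball (y₀ : S1) r ∩
      Ioc (y₀ - Real.pi) (y₀ - Real.pi + 2 * Real.pi) ⊆
        Icc (y₀ - Real.pi * r / 2) (y₀ + Real.pi * r / 2) := by
    rintro y ⟨h1, h2, h3⟩
    have h1' : chord (y : S1) (y₀ : S1) < r := h1
    have h4 := pow_lt_pow_left₀ h1' (chord_nonneg _ _) two_ne_zero
    rw [sq_chord_coe] at h4
    have h5 : |y - y₀| ≤ Real.pi := abs_le.2 ⟨by linarith, by linarith⟩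
    -- The quadratic upper bound for the cosine on `[-π, π]` says that the chord is at least `2/π`
    -- times the arc.
    have h6 := Real.cos_le_one_sub_mul_cos_sq h5
    have h7 : (2 / Real.pi * (y - y₀)) ^ 2 ≤ r ^ 2 := by
      calc _ = 2 - 2 * (1 - 2 / Real.pi ^ 2 * (y - y₀) ^ 2) := by field_simp; ring
        _ ≤ _ := by linarith
    have h8 := abs_le_of_sq_le_sq h7 hr
    rw [abs_le, div_mul_eq_mul_div, le_div_iff₀ hpi, div_le_iff₀ hpi] at h8
    constructor <;> linarith [h8.1, h8.2]
  refine (measure_mono h).trans ?_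
  rw [Real.volume_Icc]
  exact ENNReal.ofReal_le_ofReal (by linarith)

/-- A chord is no longer than its arc, so the ball contains an arc of length `2r`. The bound on `r`
keeps this arc inside one period. -/
theorem le_volume_ball (x₀ : S1) {r : ℝ} (hr : r ≤ 1) :
    ENNReal.ofReal (2 * r) ≤ volume (ball x₀ r) := by
  induction x₀ using QuotientAddGroup.induction_on with | H y₀ => ?_
  rw [volume_eq_volume_preimage_inter_Ioc (measurableSet_ball _ _) (y₀ - Real.pi)]
  have hpi := Real.pi_gt_three
  have h : Ioo (y₀ - r) (y₀ + r) ⊆ (fun y : ℝ => (y : S1)) ⁻¹' ball (y₀ : S1) r ∩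
      Ioc (y₀ - Real.pi) (y₀ - Real.pi + 2 * Real.pi) := by
    rintro y ⟨h1, h2⟩
    refine ⟨?_, by linarith, by linarith⟩
    change chord (y : S1) (y₀ : S1) < r
    refine lt_of_pow_lt_pow_left₀ 2 (by linarith) ?_
    rw [sq_chord_coe]
    have h3 := Real.one_sub_sq_div_two_le_cos (x := y - y₀)
    have h4 : (y - y₀) ^ 2 < r ^ 2 := sq_lt_sq' (by linarith) (by linarith)
    linarith
  refine le_trans ?_ (measure_mono h)
  rw [Real.volume_Ioo]
  exact ENNReal.ofReal_le_ofReal (by linarith)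

theorem volume_eq_smul_haar :
    (volume : Measure S1) = ENNReal.ofReal (2 * Real.pi) • AddCircle.haarAddCircle :=
  AddCircle.volume_eq_smul_haarAddCircle

theorem haar_eq_smul_volume : AddCircle.haarAddCircle (T := 2 * Real.pi) =
    (ENNReal.ofReal (2 * Real.pi))⁻¹ • (volume : Measure S1) := by
  rw [volume_eq_smul_haar, smul_smul, ENNReal.inv_mul_cancel, one_smul]
  · exact (ENNReal.ofReal_pos.2 Real.two_pi_pos).ne'
  · exact ENNReal.ofReal_ne_top

theorem haar_ball_le (x₀ : S1) {r : ℝ} (hr : 0 ≤ r) :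
    AddCircle.haarAddCircle.real (ball x₀ r) ≤ r / 2 := by
  rw [haar_eq_smul_volume, measureReal_ennreal_smul_apply, ENNReal.toReal_inv,
    ENNReal.toReal_ofReal Real.two_pi_pos.le]
  have h := ENNReal.toReal_mono ENNReal.ofReal_ne_top (volume_ball_le x₀ hr)
  rw [ENNReal.toReal_ofReal (by positivity)] at h
  calc _ ≤ (2 * Real.pi)⁻¹ * (Real.pi * r) := by gcongr; exact h
    _ = _ := by field_simp

/-! ### The cutoff function and the decay of its Fourier coefficients. -/

/-- Integration by parts for Fourier coefficients. -/
theorem fourierCoeff_eq_of_hasDerivAt {f : S1 → ℂ} {f' : S1 → ℂ}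
    (hf : ∀ y : ℝ, HasDerivAt (fun y : ℝ => f (y : S1)) (f' (y : S1)) y)
    (hf' : Continuous f') {n : ℤ} (hn : n ≠ 0) :
    fourierCoeff f n = (Complex.I * n)⁻¹ * fourierCoeff f' n := by
  have hab : (0 : ℝ) < 0 + 2 * Real.pi := by simpa using Real.pi_pos
  have hOn : ∀ g : S1 → ℂ, fourierCoeff g n = fourierCoeffOn hab (fun y : ℝ => g (y : S1)) n := by
    intro g
    have h2 : (0 : ℝ) + 2 * Real.pi - 0 = 2 * Real.pi := by ring
    rw [fourierCoeff_eq_intervalIntegral g n 0, fourierCoeffOn_eq_integral, h2]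
  rw [hOn, hOn, fourierCoeffOn_of_hasDerivAt hab hn (fun x _ => hf x)
    ((hf'.comp (AddCircle.continuous_mk' _)).intervalIntegrable _ _)]
  have h3 : ((0 + 2 * Real.pi : ℝ) : S1) = ((0 : ℝ) : S1) := by
    rw [zero_add, AddCircle.coe_period, AddCircle.coe_zero]
  rw [h3]
  have hpi : (Real.pi : ℂ) ≠ 0 := by exact_mod_cast Real.pi_ne_zero
  have hn' : (n : ℂ) ≠ 0 := by exact_mod_cast hn
  push_cast
  field_simp
  ring

theorem norm_fourierCoeff_le_of_ball {f : S1 → ℂ} {M : ℝ} (hM : 0 ≤ M) (x₀ : S1) {r : ℝ}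
    (hr : 0 ≤ r) (hfM : ∀ x, ‖f x‖ ≤ (ball x₀ r).indicator (fun _ => M) x) (n : ℤ) :
    ‖fourierCoeff f n‖ ≤ M * (r / 2) := by
  have hi : Integrable ((ball x₀ r).indicator fun _ => M)
      (AddCircle.haarAddCircle (T := 2 * Real.pi)) :=
    (integrable_const M).indicator (measurableSet_ball x₀ r)
  refine (norm_integral_le_of_norm_le hi (Filter.Eventually.of_forall fun x => ?_)).trans ?_
  · rw [norm_smul, fourier_apply, Circle.norm_coe, one_mul]
    exact hfM x
  · rw [integral_indicator_const _ (measurableSet_ball x₀ r), smul_eq_mul, mul_comm]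
    gcongr
    exact haar_ball_le x₀ hr

/-- Exponent at least 2 removes the corner at 0. Used twice, for the cube and then the square, it
makes the cubed positive part in the cutoff twice differentiable. -/
theorem hasDerivAt_max_zero_pow (n : ℕ) (z : ℝ) :
    HasDerivAt (fun z : ℝ => max 0 z ^ (n + 2)) ((n + 2) * max 0 z ^ (n + 1)) z := by
  rcases lt_trichotomy z 0 with h | h | h
  · have : (fun z : ℝ => max 0 z ^ (n + 2)) =ᶠ[nhds z] fun _ => 0 := by
      filter_upwards [gt_mem_nhds h] with y hy
      simp [max_eq_left hy.le]
    rw [max_eq_left h.le]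
    simpa using (hasDerivAt_const z (0 : ℝ)).congr_of_eventuallyEq this
  · subst h
    have h1 : HasDerivAt (fun z : ℝ => max 0 z ^ (n + 2)) 0 0 := by
      rw [hasDerivAt_iff_isLittleO_nhds_zero]
      have h2 : (fun h : ℝ => h ^ (n + 2)) =o[nhds 0] fun h : ℝ => h :=
        (Asymptotics.isLittleO_pow_id (by omega : 1 < n + 2))
      refine (Asymptotics.IsBigO.of_bound 1 (Filter.Eventually.of_forall fun h => ?_)).trans_isLittleO
        h2
      simp only [zero_add, max_self, smul_zero, sub_zero, one_mul]
      rw [zero_pow (by omega), sub_zero, norm_pow, norm_pow]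
      gcongr
      rw [Real.norm_eq_abs, Real.norm_eq_abs, abs_of_nonneg (le_max_left _ _)]
      exact max_le (abs_nonneg _) (le_abs_self _)
    simpa using h1
  · have : (fun z : ℝ => max 0 z ^ (n + 2)) =ᶠ[nhds z] fun z => z ^ (n + 2) := by
      filter_upwards [lt_mem_nhds h] with y hy
      simp [max_eq_right hy.le]
    rw [max_eq_right h.le]
    simpa using (hasDerivAt_pow (n + 2) z).congr_of_eventuallyEq this

/-- A cutoff function supported in the closure of `ball x₀ R`, with two derivatives. -/
def cutoff (x₀ : S1) (R : ℝ) : C(S1, ℂ) where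
  toFun x := ((max 0 (1 - chord x x₀ ^ 2 / R ^ 2) ^ 3 : ℝ) : ℂ)
  continuous_toFun := by
    have : Continuous fun x : S1 => chord x x₀ :=
      continuous_chord.comp (by fun_prop : Continuous fun x : S1 => (x, x₀))
    fun_prop

theorem cutoff_apply (x₀ : S1) (R : ℝ) (x : S1) :
    cutoff x₀ R x = ((max 0 (1 - chord x x₀ ^ 2 / R ^ 2) ^ 3 : ℝ) : ℂ) := rfl

theorem norm_cutoff (x₀ : S1) (R : ℝ) (x : S1) :
    ‖cutoff x₀ R x‖ = max 0 (1 - chord x x₀ ^ 2 / R ^ 2) ^ 3 := by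
  rw [cutoff_apply, Complex.norm_real, Real.norm_of_nonneg (by positivity)]

theorem norm_cutoff_le_indicator (x₀ : S1) {R : ℝ} (hR : 0 < R) (x : S1) :
    ‖cutoff x₀ R x‖ ≤ (ball x₀ R).indicator 1 x := by
  rw [norm_cutoff]
  by_cases h : x ∈ ball x₀ R
  · rw [indicator_of_mem h, Pi.one_apply]
    refine pow_le_one₀ (le_max_left _ _) (max_le zero_le_one ?_)
    have : 0 ≤ chord x x₀ ^ 2 / R ^ 2 := by positivity
    linarith
  · rw [indicator_of_notMem h, max_eq_left]
    · simp
    · have h' : R ≤ chord x x₀ := not_lt.1 h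
      rw [sub_nonpos, le_div_iff₀ (by positivity), one_mul]
      gcongr

theorem le_norm_cutoff (x₀ : S1) {R : ℝ} (hR : 0 < R) {x : S1} (hx : x ∈ ball x₀ (3 * R / 4)) :
    (7 / 16) ^ 3 ≤ ‖cutoff x₀ R x‖ := by
  rw [norm_cutoff]
  gcongr
  refine le_max_of_le_right ?_
  have h1 : chord x x₀ < 3 * R / 4 := hx
  have h2 : chord x x₀ ^ 2 / R ^ 2 ≤ 9 / 16 := by
    rw [div_le_iff₀ (by positivity)]
    calc _ ≤ (3 * R / 4) ^ 2 := by gcongr; exact chord_nonneg _ _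
      _ = _ := by ring
  linarith

/-- Integration by parts requires the derivatives of the cutoff as continuous functions on the
circle itself; these are polynomial in the descended cosine and sine and a positive part. -/
theorem exists_cos_sin (y₀ : ℝ) : ∃ c s : S1 → ℝ, Continuous c ∧ Continuous s ∧
    (∀ y : ℝ, c (y : S1) = Real.cos (y - y₀)) ∧ ∀ y : ℝ, s (y : S1) = Real.sin (y - y₀) := by
  have hc : Function.Periodic (fun y : ℝ => Real.cos (y - y₀)) (2 * Real.pi) :=
    fun y => by
    beta_reduce
    rw [add_sub_right_comm, Real.cos_add_two_pi]
  have hs : Function.Periodic (fun y : ℝ => Real.sin (y - y₀)) (2 * Real.pi) :=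
    fun y => by
    beta_reduce
    rw [add_sub_right_comm, Real.sin_add_two_pi]
  refine ⟨hc.lift, hs.lift, ?_, ?_, fun y => rfl, fun y => rfl⟩
  · exact continuous_coinduced_dom.2 (by fun_prop : Continuous fun y : ℝ => Real.cos (y - y₀))
  · exact continuous_coinduced_dom.2 (by fun_prop : Continuous fun y : ℝ => Real.sin (y - y₀))

/-- Two integrations by parts give `n⁻²`. The second derivative is at most `30 / R²` and lives on a
ball of normalized measure at most `R / 2`. -/
theorem norm_fourierCoeff_cutoff_le (x₀ : S1) {R : ℝ} (hR : 0 < R) {n : ℤ} (hn : n ≠ 0) :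
    ‖fourierCoeff (cutoff x₀ R) n‖ ≤ 15 / R * (1 / (n : ℝ) ^ 2) := by
  induction x₀ using QuotientAddGroup.induction_on with | H y₀ => ?_
  obtain ⟨c, s, hc, hs, hcy, hsy⟩ := exists_cos_sin y₀
  set z : S1 → ℝ := fun x => 1 - (2 - 2 * c x) / R ^ 2 with hz
  have hzy : ∀ y : ℝ, HasDerivAt (fun y : ℝ => z y) (-(2 * s y) / R ^ 2) y := fun y => by
    simp only [hz, hcy, hsy]
    have h1 : HasDerivAt (fun y => Real.cos (y - y₀)) (-Real.sin (y - y₀) * 1) y :=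
      (Real.hasDerivAt_cos _).comp y ((hasDerivAt_id y).sub_const y₀)
    refine ((((h1.const_mul 2).const_sub 2).div_const (R ^ 2)).const_sub 1).congr_deriv ?_
    ring
  have hsy' : ∀ y : ℝ, HasDerivAt (fun y : ℝ => -(2 * s y) / R ^ 2) (-(2 * c y) / R ^ 2) y := by
    intro y
    simp only [hcy, hsy]
    have h1 : HasDerivAt (fun y => Real.sin (y - y₀)) (Real.cos (y - y₀) * 1) y :=
      (Real.hasDerivAt_sin _).comp y ((hasDerivAt_id y).sub_const y₀)
    refine (((h1.const_mul 2).neg).div_const (R ^ 2)).congr_deriv ?_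
    ring
  set f₁ : S1 → ℝ := fun x => 3 * max 0 (z x) ^ 2 * (-(2 * s x) / R ^ 2) with hf₁
  set f₂ : S1 → ℝ := fun x => 6 * max 0 (z x) * (-(2 * s x) / R ^ 2) * (-(2 * s x) / R ^ 2) +
    3 * max 0 (z x) ^ 2 * (-(2 * c x) / R ^ 2) with hf₂
  have hz0 : ∀ x, z x = 1 - chord x y₀ ^ 2 / R ^ 2 := fun x => by
    induction x using QuotientAddGroup.induction_on with | H y => ?_
    change 1 - (2 - 2 * c (y : S1)) / R ^ 2 = 1 - chord (y : S1) (y₀ : S1) ^ 2 / R ^ 2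
    rw [sq_chord_coe, hcy]
  have hd0 : ∀ y : ℝ, HasDerivAt (fun y : ℝ => cutoff y₀ R (y : S1)) ((f₁ y : ℝ) : ℂ) y := by
    intro y
    simp only [cutoff_apply, ← hz0]
    refine HasDerivAt.ofReal_comp (f := fun y : ℝ => max 0 (z y) ^ 3) ?_
    refine ((hasDerivAt_max_zero_pow 1 (z y)).comp y (hzy y)).congr_deriv ?_
    simp only [hf₁]
    norm_num
  have hd1 : ∀ y : ℝ, HasDerivAt (fun y : ℝ => ((f₁ y : ℝ) : ℂ)) ((f₂ y : ℝ) : ℂ) y := by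
    intro y
    refine HasDerivAt.ofReal_comp (f := fun y : ℝ => f₁ y) ?_
    refine ((((hasDerivAt_max_zero_pow 0 (z y)).comp y (hzy y)).const_mul 3).mul
      (hsy' y)).congr_deriv ?_
    simp only [hf₂, Function.comp_apply, Nat.cast_zero, zero_add, pow_one]
    ring
  have hzc : Continuous z := by fun_prop
  rw [fourierCoeff_eq_of_hasDerivAt (f' := fun x => ((f₁ x : ℝ) : ℂ)) hd0 (by fun_prop) hn,
    fourierCoeff_eq_of_hasDerivAt (f' := fun x => ((f₂ x : ℝ) : ℂ)) hd1 (by fun_prop) hn]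
  have hb : ∀ x, ‖((f₂ x : ℝ) : ℂ)‖ ≤ (ball (y₀ : S1) R).indicator (fun _ => 30 / R ^ 2) x := by
    intro x
    rw [Complex.norm_real]
    by_cases hx : 0 < z x
    · have h1 : x ∈ ball (y₀ : S1) R := by
        rw [hz0, sub_pos, div_lt_one (by positivity)] at hx
        exact lt_of_pow_lt_pow_left₀ 2 hR.le hx
      rw [indicator_of_mem h1]
      have hzx : z x = 1 - (2 - 2 * c x) / R ^ 2 := rfl
      have hcs : s x ^ 2 + c x ^ 2 = 1 := by
        induction x using QuotientAddGroup.induction_on with | H y => ?_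
        rw [hcy, hsy, Real.sin_sq_add_cos_sq]
      have hc1 : |c x| ≤ 1 := abs_le_one_iff_mul_self_le_one.2 (by nlinarith [sq_nonneg (s x)])
      obtain ⟨hc2, hc3⟩ := abs_le.1 hc1
      have hR2 : 0 < R ^ 2 := by positivity
      have h2 : 2 - 2 * c x < R ^ 2 := by
        rw [hzx, sub_pos, div_lt_one hR2] at hx; exact hx
      -- Here `s² = (1 - c)(1 + c) ≤ 2 (1 - c) < R²`.
      have hs2 : s x ^ 2 ≤ R ^ 2 := by nlinarith
      have hz1 : z x ≤ 1 := by
        rw [hzx]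
        have : 0 ≤ (2 - 2 * c x) / R ^ 2 := div_nonneg (by linarith) hR2.le
        linarith
      have hf : f₂ x = (24 * z x * (s x ^ 2 / R ^ 2) - 6 * z x ^ 2 * c x) / R ^ 2 := by
        simp only [hf₂, max_eq_right hx.le]
        field_simp
        ring
      have hs3 : s x ^ 2 / R ^ 2 ≤ 1 := (div_le_one hR2).2 hs2
      have hs4 : 0 ≤ s x ^ 2 / R ^ 2 := by positivity
      rw [hf, norm_div, Real.norm_of_nonneg hR2.le]
      gcongr
      refine (norm_sub_le _ _).trans ?_
      rw [Real.norm_of_nonneg (by positivity), norm_mul, Real.norm_of_nonneg (by positivity),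
        Real.norm_eq_abs]
      have h5 : z x * (s x ^ 2 / R ^ 2) ≤ 1 := mul_le_one₀ hz1 hs4 hs3
      have h6 : z x ^ 2 * |c x| ≤ 1 := mul_le_one₀ (pow_le_one₀ hx.le hz1) (abs_nonneg _) hc1
      linarith
    · have h1 : f₂ x = 0 := by simp [hf₂, max_eq_left (not_lt.1 hx)]
      rw [h1, norm_zero]
      exact indicator_nonneg (fun _ _ => by positivity) _
  have h := norm_fourierCoeff_le_of_ball (by positivity) (y₀ : S1) hR.le hb n
  have hn' : 0 < |(n : ℝ)| := abs_pos.2 (by exact_mod_cast hn)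
  rw [norm_mul, norm_mul, norm_inv, norm_mul, Complex.norm_I, one_mul, Complex.norm_intCast]
  calc _ ≤ |(n : ℝ)|⁻¹ * (|(n : ℝ)|⁻¹ * (30 / R ^ 2 * (R / 2))) := by gcongr
    _ = _ := by
      rw [← sq_abs (n : ℝ)]
      field_simp
      norm_num

theorem summable_fourierCoeff_cutoff (x₀ : S1) {R : ℝ} (hR : 0 < R) :
    Summable (fourierCoeff (cutoff x₀ R)) := by
  have h : Summable fun n : ℤ => 15 / R * (1 / (n : ℝ) ^ 2) :=
    (Real.summable_one_div_int_pow.2 one_lt_two).mul_left _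
  refine Summable.of_norm_bounded_eventually h ?_
  filter_upwards [(Set.finite_singleton (0 : ℤ)).compl_mem_cofinite] with n hn
  exact norm_fourierCoeff_cutoff_le x₀ hR hn

/-- The `ℓ¹` norm of `|n|^{1/2} η̂(n)` is at most `C / R` for the cutoff `η`. -/
theorem exists_tsum_sqrt_mul_fourierCoeff_cutoff_le : ∃ K : ℝ≥0, ∀ (x₀ : S1) (R : ℝ), 0 < R →
    ∑' n : ℤ, ENNReal.ofReal (√|(n : ℝ)|) * ‖fourierCoeff (cutoff x₀ R) n‖ₑ ≤
      ENNReal.ofReal (K / R) := by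
  have hs : Summable fun n : ℤ => √|(n : ℝ)| * (1 / (n : ℝ) ^ 2) := by
    have h := Real.summable_abs_int_rpow (b := 3 / 2) (by norm_num)
    refine h.congr fun n => ?_
    rcases eq_or_ne n 0 with rfl | hn
    · simp
    · have hn' : 0 < |(n : ℝ)| := abs_pos.2 (by exact_mod_cast hn)
      rw [← sq_abs, Real.sqrt_eq_rpow, ← Real.rpow_natCast, one_div, one_div, ← Real.rpow_neg hn'.le,
        ← Real.rpow_add hn']
      norm_num
  have hnn : ∀ n : ℤ, 0 ≤ √|(n : ℝ)| * (1 / (n : ℝ) ^ 2) := fun n => by positivity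
  refine ⟨⟨15 * ∑' n : ℤ, √|(n : ℝ)| * (1 / (n : ℝ) ^ 2),
    mul_nonneg (by norm_num) (tsum_nonneg hnn)⟩, fun x₀ R hR => ?_⟩
  have h1 : ∀ n : ℤ, ENNReal.ofReal (√|(n : ℝ)|) * ‖fourierCoeff (cutoff x₀ R) n‖ₑ ≤
      ENNReal.ofReal (15 / R * (√|(n : ℝ)| * (1 / (n : ℝ) ^ 2))) := fun n => by
    rcases eq_or_ne n 0 with rfl | hn
    · simp
    · rw [← ofReal_norm, ← ENNReal.ofReal_mul (by positivity), mul_left_comm]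
      refine ENNReal.ofReal_le_ofReal ?_
      gcongr
      exact norm_fourierCoeff_cutoff_le x₀ hR hn
  refine (ENNReal.tsum_le_tsum h1).trans ?_
  rw [← ENNReal.ofReal_tsum_of_nonneg (fun n => mul_nonneg (by positivity) (hnn n))
    (hs.mul_left _), tsum_mul_left]
  refine ENNReal.ofReal_le_ofReal (le_of_eq ?_)
  change _ = (15 * ∑' n : ℤ, √|(n : ℝ)| * (1 / (n : ℝ) ^ 2)) / R
  ring

/-! ### The fractional Laplacian and the localized inequality for one component. -/

/-- The Fourier coefficients of `f` satisfy `∑ |k|² |f̂(k)|² < ∞`. -/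
def HasH1Coeff (f : S1 → ℂ) : Prop :=
  Memℓp (fun k : ℤ => ((|(k : ℝ)| : ℝ) : ℂ) * fourierCoeff f k) 2

theorem HasH1Coeff.half {f : S1 → ℂ} (hf : HasH1Coeff f) :
    Memℓp (fun k : ℤ => ((|(k : ℝ)| ^ (2 * (1 / 2 : ℝ)) : ℝ) : ℂ) * fourierCoeff f k) 2 := by
  norm_num
  exact hf

theorem rpow_two_mul_quarter (a : ℝ) : a ^ (2 * (1 / 4 : ℝ)) = √a := by
  rw [Real.sqrt_eq_rpow]
  norm_num

/-- Frequencies are integers, so `√|k| ≤ |k|`. This places `scalarFracLaplacian` in its genuine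
branch and not at the default value 0. -/
theorem HasH1Coeff.quarter {f : S1 → ℂ} (hf : HasH1Coeff f) :
    Memℓp (fun k : ℤ => ((|(k : ℝ)| ^ (2 * (1 / 4 : ℝ)) : ℝ) : ℂ) * fourierCoeff f k) 2 := by
  refine Memℓp.mono' hf fun k => ?_
  rw [norm_mul, norm_mul, Complex.norm_real, Complex.norm_real, rpow_two_mul_quarter,
    Real.norm_of_nonneg (Real.sqrt_nonneg _), Real.norm_of_nonneg (abs_nonneg _)]
  gcongr
  rw [Real.sqrt_le_left (abs_nonneg _), sq_abs]
  have h : |k| ≤ k ^ 2 := by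
    rw [← sq_abs]
    exact Int.le_self_sq _
  exact_mod_cast h

theorem HasH1Coeff.fourierCoeff_quarter {f : S1 → ℂ} (hf : HasH1Coeff f) (k : ℤ) :
    fourierCoeff (scalarFracLaplacian (1 / 4) f) k = (√|(k : ℝ)| : ℝ) * fourierCoeff f k := by
  rw [fourierCoeff_scalarFracLaplacian _ _ hf.quarter, rpow_two_mul_quarter]

theorem HasH1Coeff.fourierCoeff_half {f : S1 → ℂ} (hf : HasH1Coeff f) (k : ℤ) :
    fourierCoeff (scalarFracLaplacian (1 / 2) f) k =
      (√|(k : ℝ)| : ℝ) * fourierCoeff (scalarFracLaplacian (1 / 4) f) k := by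
  rw [fourierCoeff_scalarFracLaplacian _ _ hf.half, hf.fourierCoeff_quarter, ← mul_assoc,
    ← Complex.ofReal_mul, Real.mul_self_sqrt (abs_nonneg _)]
  norm_num

theorem lintegral_volume_eq (F : S1 → ℝ≥0∞) (s : Set S1) :
    ∫⁻ x in s, F x = ENNReal.ofReal (2 * Real.pi) * ∫⁻ x in s, F x ∂AddCircle.haarAddCircle := by
  rw [volume_eq_smul_haar, Measure.restrict_smul, lintegral_smul_measure, smul_eq_mul]

theorem lintegral_volume_univ_eq (F : S1 → ℝ≥0∞) :
    ∫⁻ x, F x = ENNReal.ofReal (2 * Real.pi) * ∫⁻ x, F x ∂AddCircle.haarAddCircle := by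
  rw [volume_eq_smul_haar, lintegral_smul_measure, smul_eq_mul]

theorem lintegral_enorm_cutoff_mul_sq_le {v : S1 → ℂ} (x₀ : S1) {R : ℝ} (hR : 0 < R) :
    ∫⁻ x, ‖cutoff x₀ R x * v x‖ₑ ^ 2 ∂AddCircle.haarAddCircle ≤
      ∫⁻ x in ball x₀ R, ‖v x‖ₑ ^ 2 ∂AddCircle.haarAddCircle := by
  rw [← lintegral_indicator (measurableSet_ball x₀ R)]
  refine lintegral_mono fun x => ?_
  have h := norm_cutoff_le_indicator x₀ hR x
  by_cases hx : x ∈ ball x₀ R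
  · rw [indicator_of_mem hx] at h ⊢
    rw [enorm_mul]
    have h1 : ‖cutoff x₀ R x‖ₑ ≤ 1 := by
      rw [← ofReal_norm, ← ENNReal.ofReal_one]
      exact ENNReal.ofReal_le_ofReal h
    exact pow_le_pow_left' ((mul_le_mul_left h1 _).trans_eq (one_mul _)) 2
  · rw [indicator_of_notMem hx] at h ⊢
    have : cutoff x₀ R x = 0 := norm_le_zero_iff.1 h
    simp [this]

theorem memLp_cutoff_mul (x₀ : S1) (R : ℝ) {v : S1 → ℂ}
    (hv : MemLp v 2 (AddCircle.haarAddCircle (T := 2 * Real.pi))) :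
    MemLp (fun x => cutoff x₀ R x * v x) 2 (AddCircle.haarAddCircle (T := 2 * Real.pi)) := by
  refine MemLp.of_le_mul (c := ‖cutoff x₀ R‖) hv
    ((cutoff x₀ R).continuous.aestronglyMeasurable.mul hv.1) (Filter.Eventually.of_forall fun x => ?_)
  rw [norm_mul]
  gcongr
  exact (cutoff x₀ R).norm_coe_le_norm x

/-- The localized Gagliardo–Nirenberg inequality for one component. -/
theorem exists_lintegral_cutoff_mul_pow_four_le : ∃ A : ℝ≥0, 0 < A ∧
    ∀ (x₀ : S1) (R : ℝ), 0 < R → R < 1 → ∀ v g : S1 → ℂ,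
      MemLp v 2 (AddCircle.haarAddCircle (T := 2 * Real.pi)) →
      MemLp g 2 (AddCircle.haarAddCircle (T := 2 * Real.pi)) →
      (∀ k : ℤ, fourierCoeff g k = (√|(k : ℝ)| : ℝ) * fourierCoeff v k) →
      ∫⁻ x, ‖cutoff x₀ R x * v x‖ₑ ^ 4 ≤ A * (∫⁻ x in ball x₀ R, ‖v x‖ₑ ^ 2) *
        ((∫⁻ x in ball x₀ R, ‖g x‖ₑ ^ 2) + ENNReal.ofReal (1 / R ^ 2) * ∫⁻ x, ‖v x‖ₑ ^ 2) := by
  obtain ⟨K, hK⟩ := exists_tsum_sqrt_mul_fourierCoeff_cutoff_le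
  -- 32 is the Gagliardo–Nirenberg constant, and `4 K² + 5` dominates both coefficients 4 and `4 K²
  -- + 1` of the final bracket.
  refine ⟨32 * (4 * K ^ 2 + 5), by positivity, fun x₀ R hR hR1 v g hv hg hvg => ?_⟩
  have hw := memLp_cutoff_mul x₀ R hv
  have hGN := lintegral_enorm_pow_four_le hw
  have hcomm := tsum_abs_mul_fourierCoeff_mul_le (summable_fourierCoeff_cutoff x₀ hR)
    (hv.integrable (by norm_num)) (hg.integrable (by norm_num)) hvg
  rw [← lintegral_enorm_sq_eq_tsum hv, ← lintegral_enorm_sq_eq_tsum (memLp_cutoff_mul x₀ R hg)]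
    at hcomm
  have hsplit : ∑' k : ℤ, ENNReal.ofReal (2 * |(k : ℝ)| + 1) *
        ‖fourierCoeff (fun x => cutoff x₀ R x * v x) k‖ₑ ^ 2 =
      2 * ∑' k : ℤ, ENNReal.ofReal |(k : ℝ)| *
        ‖fourierCoeff (fun x => cutoff x₀ R x * v x) k‖ₑ ^ 2 +
      ∑' k : ℤ, ‖fourierCoeff (fun x => cutoff x₀ R x * v x) k‖ₑ ^ 2 := by
    rw [← ENNReal.tsum_mul_left, ← ENNReal.tsum_add]
    refine tsum_congr fun k => ?_
    rw [ENNReal.ofReal_add (by positivity) zero_le_one, ENNReal.ofReal_mul zero_le_two]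
    simp only [ENNReal.ofReal_ofNat, ENNReal.ofReal_one]
    ring
  rw [hsplit, ← lintegral_enorm_sq_eq_tsum hw] at hGN
  have hX := lintegral_enorm_cutoff_mul_sq_le (v := v) x₀ hR
  have hG := lintegral_enorm_cutoff_mul_sq_le (v := g) x₀ hR
  set ρ := ENNReal.ofReal (1 / R ^ 2) with hρ
  have hρ1 : 1 ≤ ρ := by
    rw [hρ, ← ENNReal.ofReal_one]
    refine ENNReal.ofReal_le_ofReal ?_
    rw [le_div_iff₀ (by positivity), one_mul]
    exact pow_le_one₀ hR.le hR1.le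
  have hKR : ENNReal.ofReal (K / R) ^ 2 = K ^ 2 * ρ := by
    rw [← ENNReal.ofReal_pow (by positivity), div_pow, div_eq_mul_one_div,
      ENNReal.ofReal_mul (by positivity), ENNReal.ofReal_pow (by positivity)]
    simp [hρ]
  -- Passing from Haar measure to arc length gives one factor `2π` on the left and two on the right;
  -- the extra one only helps.
  have hc1 : 1 ≤ ENNReal.ofReal (2 * Real.pi) := by
    rw [← ENNReal.ofReal_one]
    exact ENNReal.ofReal_le_ofReal (by linarith [Real.pi_gt_three])
  rw [lintegral_volume_univ_eq, lintegral_volume_univ_eq fun x => ‖v x‖ₑ ^ 2, lintegral_volume_eq,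
    lintegral_volume_eq]
  set c := ENNReal.ofReal (2 * Real.pi)
  set x := ∫⁻ x in ball x₀ R, ‖v x‖ₑ ^ 2 ∂AddCircle.haarAddCircle
  set y := ∫⁻ x in ball x₀ R, ‖g x‖ₑ ^ 2 ∂AddCircle.haarAddCircle
  set d := ∫⁻ x, ‖v x‖ₑ ^ 2 ∂AddCircle.haarAddCircle (T := 2 * Real.pi)
  have hxd : x ≤ d := setLIntegral_le_lintegral _ _
  calc _ ≤ c * (32 * x * (2 * (2 * y + 2 * (K ^ 2 * ρ) * d) + ρ * d)) := by
        refine mul_le_mul_right (hGN.trans ?_) c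
        refine mul_le_mul' (mul_le_mul_right hX _) (add_le_add (mul_le_mul_right
          (hcomm.trans (add_le_add (mul_le_mul_right hG _) ?_)) _) ?_)
        · rw [← hKR]
          gcongr
          exact hK x₀ R hR
        · calc _ ≤ x := hX
            _ ≤ 1 * d := by rwa [one_mul]
            _ ≤ _ := mul_le_mul_left hρ1 _
    _ = c * 1 * (32 * x * (4 * y + (4 * K ^ 2 + 1) * (ρ * d))) := by ring
    _ ≤ c * c * (32 * x * ((4 * K ^ 2 + 5) * y + (4 * K ^ 2 + 5) * (ρ * d))) := by
        gcongr
        · exact le_add_left (by norm_num)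
        · norm_num
    _ = _ := by
        push_cast
        ring

/-! ### Vector-valued functions and the local slice estimate. -/

/-- Expanding the square, each cross term is at most the geometric mean of two products, hence at
most `A (X_i Y_j + X_j Y_i)`. The double sum then factors, so the number of components does not
enter the constant. -/
theorem lintegral_finset_sum_sq_le {α ι : Type*} [MeasurableSpace α] (μ : Measure α) (s : Finset ι)
    {p : ι → α → ℝ≥0∞} (hp : ∀ i, AEMeasurable (p i) μ) {X Y : ι → ℝ≥0∞} {A : ℝ≥0∞}
    (h : ∀ i, ∫⁻ a, p i a ^ 2 ∂μ ≤ A * X i * Y i) :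
    ∫⁻ a, (∑ i ∈ s, p i a) ^ 2 ∂μ ≤ 2 * A * (∑ i ∈ s, X i) * ∑ i ∈ s, Y i := by
  have hij : ∀ i j, ∫⁻ a, p i a * p j a ∂μ ≤ A * (X i * Y j + X j * Y i) := fun i j => by
    rw [← ENNReal.pow_le_pow_left_iff two_ne_zero]
    calc _ ≤ _ := sq_lintegral_mul_le μ (hp i) (hp j)
      _ ≤ A * X i * Y i * (A * X j * Y j) := mul_le_mul' (h i) (h j)
      _ = A ^ 2 * ((X i * Y j) * (X j * Y i)) := by ring
      _ ≤ A ^ 2 * ((X i * Y j + X j * Y i) * (X i * Y j + X j * Y i)) := by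
        gcongr
        · exact le_self_add
        · exact le_add_self
      _ = _ := by ring
  calc ∫⁻ a, (∑ i ∈ s, p i a) ^ 2 ∂μ = ∑ i ∈ s, ∑ j ∈ s, ∫⁻ a, p i a * p j a ∂μ := by
        simp_rw [sq, Finset.sum_mul_sum]
        have hm : ∀ i j, AEMeasurable (fun a => p i a * p j a) μ := fun i j => (hp i).mul (hp j)
        rw [lintegral_finsetSum' _ fun i _ => Finset.aemeasurable_fun_sum _ fun j _ => hm i j]
        exact Finset.sum_congr rfl fun i _ => lintegral_finsetSum' _ fun j _ => hm i j
    _ ≤ ∑ i ∈ s, ∑ j ∈ s, A * (X i * Y j + X j * Y i) :=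
        Finset.sum_le_sum fun i _ => Finset.sum_le_sum fun j _ => hij i j
    _ = _ := by
        simp_rw [mul_add, Finset.sum_add_distrib]
        rw [Finset.sum_comm (f := fun i j => A * (X j * Y i)), ← two_mul]
        simp_rw [← Finset.mul_sum]
        rw [← Finset.sum_mul]
        ring

/-- Every component of `f` satisfies `∑ |k|² |f̂(k)|² < ∞`. -/
def HasH1Coeffs {n : ℕ} (f : S1 → EuclideanSpace ℝ (Fin n)) : Prop :=
  ∀ i, HasH1Coeff fun y => ((f y i : ℝ) : ℂ)

theorem enorm_fracLaplacian_sq {n : ℕ} (s : ℝ) (f : S1 → EuclideanSpace ℝ (Fin n)) (x : S1) :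
    ‖fracLaplacian s f x‖ₑ ^ 2 =
      ∑ i, ‖scalarFracLaplacian s (fun y => ((f y i : ℝ) : ℂ)) x‖ₑ ^ 2 := by
  rw [← ofReal_norm, ← ENNReal.ofReal_pow (norm_nonneg _), EuclideanSpace.norm_sq_eq,
    ENNReal.ofReal_sum_of_nonneg fun i _ => sq_nonneg _]
  refine Finset.sum_congr rfl fun i _ => ?_
  rw [ENNReal.ofReal_pow (norm_nonneg _), ofReal_norm]
  rfl

theorem volume_absolutelyContinuous_haar :
    (volume : Measure S1) ≪ AddCircle.haarAddCircle (T := 2 * Real.pi) := by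
  rw [volume_eq_smul_haar]
  exact Measure.smul_absolutelyContinuous

theorem aemeasurable_enorm_scalarFracLaplacian (s : ℝ) (f : S1 → ℂ) :
    AEMeasurable (fun x => ‖scalarFracLaplacian s f x‖ₑ) (volume : Measure S1) :=
  ((Lp.aestronglyMeasurable _).mono_ac volume_absolutelyContinuous_haar).enorm

theorem aemeasurable_enorm_fracLaplacian_sq {n : ℕ} (s : ℝ) (f : S1 → EuclideanSpace ℝ (Fin n)) :
    AEMeasurable (fun x => ‖fracLaplacian s f x‖ₑ ^ 2) (volume : Measure S1) := by
  simp_rw [enorm_fracLaplacian_sq]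
  exact Finset.aemeasurable_fun_sum _ fun i _ =>
    (aemeasurable_enorm_scalarFracLaplacian _ _).pow_const 2

theorem sliceInt_two_eq_sum {n : ℕ} (s : ℝ) (B : Set S1) (f : S1 → EuclideanSpace ℝ (Fin n)) :
    sliceInt s 2 B f =
      ∑ i, ∫⁻ x in B, ‖scalarFracLaplacian s (fun y => ((f y i : ℝ) : ℂ)) x‖ₑ ^ 2 := by
  unfold sliceInt
  simp_rw [enorm_fracLaplacian_sq]
  exact lintegral_finsetSum' _ fun i _ =>
    ((aemeasurable_enorm_scalarFracLaplacian _ _).pow_const 2).restrict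

theorem lintegral_scalarFracLaplacian_sq_eq (s : ℝ) (f : S1 → ℂ) :
    ∫⁻ x, ‖scalarFracLaplacian s f x‖ₑ ^ 2 =
      ENNReal.ofReal (2 * Real.pi) * ∑' k : ℤ, ‖fourierCoeff (scalarFracLaplacian s f) k‖ₑ ^ 2 := by
  rw [lintegral_volume_univ_eq, lintegral_enorm_sq_eq_tsum (Lp.memLp _)]

theorem sliceInt_two_ne_top {n : ℕ} (s : ℝ) (B : Set S1) (f : S1 → EuclideanSpace ℝ (Fin n)) :
    sliceInt s 2 B f ≠ ⊤ := by
  rw [sliceInt_two_eq_sum]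
  refine ENNReal.sum_ne_top.2 fun i _ => ne_top_of_le_ne_top ?_ (setLIntegral_le_lintegral _ _)
  rw [lintegral_volume_univ_eq]
  refine ENNReal.mul_ne_top ENNReal.ofReal_ne_top ?_
  have h := (Lp.memLp (scalarFracLaplacian s fun y => ((f y i : ℝ) : ℂ))).eLpNorm_lt_top
  rw [eLpNorm_lt_top_iff_lintegral_rpow_enorm_lt_top two_ne_zero ENNReal.ofNat_ne_top] at h
  simpa using h.ne

/-- The local estimate on a time slice. -/
theorem exists_sliceInt_ball_le : ∃ A : ℝ≥0, 0 < A ∧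
    ∀ (n : ℕ) (f : S1 → EuclideanSpace ℝ (Fin n)), HasH1Coeffs f →
      ∀ (x₀ : S1) (R : ℝ), 0 < R → R < 1 →
        sliceInt (1 / 4) 4 (ball x₀ (3 * R / 4)) f ≤ A * sliceInt (1 / 4) 2 (ball x₀ R) f *
          (sliceInt (1 / 2) 2 (ball x₀ R) f +
            ENNReal.ofReal (1 / R ^ 2) * sliceInt (1 / 4) 2 univ f) := by
  obtain ⟨A, hA, h⟩ := exists_lintegral_cutoff_mul_pow_four_le
  -- On the smaller ball the cutoff is at least `(1 - (3/4)²)³ = (7/16)³`, and it enters to the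
  -- fourth power; `2 A` comes from summing components.
  refine ⟨(16 / 7) ^ 12 * (2 * A), by positivity, fun n f hf x₀ R hR hR1 => ?_⟩
  set v : Fin n → S1 → ℂ := fun i => scalarFracLaplacian (1 / 4) (fun y => ((f y i : ℝ) : ℂ)) with hv
  set g : Fin n → S1 → ℂ := fun i => scalarFracLaplacian (1 / 2) (fun y => ((f y i : ℝ) : ℂ)) with hg
  have hsum := lintegral_finset_sum_sq_le volume Finset.univ
    (p := fun i x => ‖cutoff x₀ R x * v i x‖ₑ ^ 2) (A := A)
    (X := fun i => ∫⁻ x in ball x₀ R, ‖v i x‖ₑ ^ 2)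
    (Y := fun i => (∫⁻ x in ball x₀ R, ‖g i x‖ₑ ^ 2) +
      ENNReal.ofReal (1 / R ^ 2) * ∫⁻ x, ‖v i x‖ₑ ^ 2)
    (fun i => by
      simp_rw [enorm_mul]
      exact ((cutoff x₀ R).continuous.enorm.aemeasurable.mul
        (aemeasurable_enorm_scalarFracLaplacian _ _)).pow_const 2)
    (fun i => by
      simp_rw [← pow_mul]
      exact h x₀ R hR hR1 (v i) (g i) (Lp.memLp _) (Lp.memLp _) (hf i).fourierCoeff_half)
  rw [Finset.sum_add_distrib, ← Finset.mul_sum] at hsum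
  have huniv : sliceInt (1 / 4) 2 univ f = ∑ i, ∫⁻ x, ‖v i x‖ₑ ^ 2 := by
    rw [sliceInt_two_eq_sum]
    simp only [Measure.restrict_univ, hv]
  have hpt : ∀ x ∈ ball x₀ (3 * R / 4), ‖fracLaplacian (1 / 4) f x‖ₑ ^ 4 ≤
      (16 / 7 : ℝ≥0) ^ 12 * (∑ i, ‖cutoff x₀ R x * v i x‖ₑ ^ 2) ^ 2 := fun x hx => by
    have h1 : 1 ≤ ((16 / 7 : ℝ≥0) : ℝ≥0∞) ^ 3 * ‖cutoff x₀ R x‖ₑ := by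
      have h2 := le_norm_cutoff x₀ hR hx
      have h3 : (1 : ℝ≥0) ≤ (16 / 7) ^ 3 * ‖cutoff x₀ R x‖₊ := by
        rw [← NNReal.coe_le_coe]
        push_cast
        linarith
      rw [enorm_eq_nnnorm]
      exact_mod_cast h3
    calc ‖fracLaplacian (1 / 4) f x‖ₑ ^ 4 = 1 ^ 4 * (∑ i, ‖v i x‖ₑ ^ 2) ^ 2 := by
          rw [one_pow, one_mul, ← enorm_fracLaplacian_sq, ← pow_mul]
      _ ≤ ((16 / 7 : ℝ≥0) ^ 3 * ‖cutoff x₀ R x‖ₑ) ^ 4 * (∑ i, ‖v i x‖ₑ ^ 2) ^ 2 := by gcongr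
      _ = _ := by
          simp_rw [enorm_mul, mul_pow, ← Finset.mul_sum]
          ring
  rw [huniv, sliceInt_two_eq_sum, sliceInt_two_eq_sum]
  calc sliceInt (1 / 4) 4 (ball x₀ (3 * R / 4)) f
      ≤ ∫⁻ x in ball x₀ (3 * R / 4),
        (16 / 7 : ℝ≥0) ^ 12 * (∑ i, ‖cutoff x₀ R x * v i x‖ₑ ^ 2) ^ 2 :=
        setLIntegral_mono' (measurableSet_ball _ _) hpt
    _ ≤ ∫⁻ x, (16 / 7 : ℝ≥0) ^ 12 * (∑ i, ‖cutoff x₀ R x * v i x‖ₑ ^ 2) ^ 2 :=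
        setLIntegral_le_lintegral _ _
    _ = (16 / 7 : ℝ≥0) ^ 12 * ∫⁻ x, (∑ i, ‖cutoff x₀ R x * v i x‖ₑ ^ 2) ^ 2 :=
        lintegral_const_mul' _ _ (by finiteness)
    _ ≤ _ := by
        refine (mul_le_mul_right hsum _).trans_eq ?_
        push_cast
        ring

/-! ### The global slice estimate by averaging. -/

/-- Averaging a local integral over the centre of the ball. -/
theorem lintegral_setLIntegral_ball {F : S1 → ℝ≥0∞} (hF : AEMeasurable F) (r : ℝ) :
    ∫⁻ x₀, ∫⁻ x in ball x₀ r, F x = ∫⁻ x, F x * volume (ball x r) := by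
  have hS : MeasurableSet {p : S1 × S1 | chord p.2 p.1 < r} :=
    (isOpen_lt (continuous_chord.comp continuous_swap) continuous_const).measurableSet
  have h1 : ∀ x₀, ∫⁻ x in ball x₀ r, F x =
      ∫⁻ x, {p : S1 × S1 | chord p.2 p.1 < r}.indicator (fun p => F p.2) (x₀, x) := fun x₀ => by
    rw [← lintegral_indicator (measurableSet_ball x₀ r)]
    rfl
  simp_rw [h1]
  rw [lintegral_lintegral_swap (f := fun x₀ x => {p : S1 × S1 | chord p.2 p.1 < r}.indicator
    (fun p => F p.2) (x₀, x)) ((hF.comp_quasiMeasurePreserving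
      Measure.quasiMeasurePreserving_snd).indicator hS)]
  refine lintegral_congr fun x => ?_
  have h2 : ∀ x₀, {p : S1 × S1 | chord p.2 p.1 < r}.indicator (fun p => F p.2) (x₀, x) =
      (ball x r).indicator (fun _ => F x) x₀ := fun x₀ => by
    simp only [indicator, ball, mem_ofPred_eq, chord_comm x x₀]
    congr
  simp_rw [h2]
  rw [lintegral_indicator_const (measurableSet_ball x r)]

/-- The global estimate on a time slice. -/
theorem exists_sliceInt_univ_le : ∃ A : ℝ≥0, 0 < A ∧
    ∀ (n : ℕ) (f : S1 → EuclideanSpace ℝ (Fin n)), HasH1Coeffs f → ∀ R : ℝ, 0 < R → R < 1 →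
      sliceInt (1 / 4) 4 univ f ≤ A * (⨆ x : S1, sliceInt (1 / 4) 2 (ball x R) f) *
        (sliceInt (1 / 2) 2 univ f + ENNReal.ofReal (1 / R ^ 3) * sliceInt (1 / 4) 2 univ f) := by
  obtain ⟨A, hA, h⟩ := exists_sliceInt_ball_le
  -- Dividing by the lower volume bound `3R/2` leaves `2π/3` for the local term and `4π / (3R)` for
  -- the nonlocal one; both numerical constants are below 5.
  refine ⟨5 * A, by positivity, fun n f hf R hR hR1 => ?_⟩
  set S := ⨆ x : S1, sliceInt (1 / 4) 2 (ball x R) f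
  set D := sliceInt (1 / 4) 2 univ f
  set G := sliceInt (1 / 2) 2 univ f
  -- Finiteness lets `A * S` leave the integral over centres without measurability of the rest of
  -- the integrand.
  have hS : S ≠ ⊤ := ne_top_of_le_ne_top (sliceInt_two_ne_top (1 / 4) univ f)
    (iSup_le fun x => lintegral_mono_set (subset_univ _))
  have hF4 : AEMeasurable (fun x => ‖fracLaplacian (1 / 4) f x‖ₑ ^ 4) (volume : Measure S1) := by
    have := (aemeasurable_enorm_fracLaplacian_sq (1 / 4) f).pow_const 2
    simp_rw [← pow_mul] at this
    exact this
  have hleft : ENNReal.ofReal (3 * R / 2) * sliceInt (1 / 4) 4 univ f ≤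
      ∫⁻ x₀, sliceInt (1 / 4) 4 (ball x₀ (3 * R / 4)) f := by
    unfold sliceInt
    rw [lintegral_setLIntegral_ball hF4, setLIntegral_univ,
      ← lintegral_const_mul' _ _ ENNReal.ofReal_ne_top]
    refine lintegral_mono fun x => ?_
    rw [mul_comm]
    refine mul_le_mul_right (le_trans (ENNReal.ofReal_le_ofReal (by linarith))
      (le_volume_ball x (by linarith))) _
  have hG : ∫⁻ x₀, sliceInt (1 / 2) 2 (ball x₀ R) f ≤ ENNReal.ofReal (Real.pi * R) * G := by
    simp only [sliceInt, G]
    rw [lintegral_setLIntegral_ball (aemeasurable_enorm_fracLaplacian_sq _ f), setLIntegral_univ,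
      ← lintegral_const_mul' _ _ ENNReal.ofReal_ne_top]
    refine lintegral_mono fun x => ?_
    rw [mul_comm]
    exact mul_le_mul_left (volume_ball_le x hR.le) _
  have hright : ∫⁻ x₀, sliceInt (1 / 4) 4 (ball x₀ (3 * R / 4)) f ≤
      A * S * (ENNReal.ofReal (Real.pi * R) * G +
        ENNReal.ofReal (1 / R ^ 2) * D * ENNReal.ofReal (2 * Real.pi)) := by
    calc _ ≤ ∫⁻ x₀, A * S * (sliceInt (1 / 2) 2 (ball x₀ R) f +
          ENNReal.ofReal (1 / R ^ 2) * D) := by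
          refine lintegral_mono fun x₀ => (h n f hf x₀ R hR hR1).trans ?_
          gcongr
          exact le_iSup (fun x : S1 => sliceInt (1 / 4) 2 (ball x R) f) x₀
      _ = A * S * ((∫⁻ x₀, sliceInt (1 / 2) 2 (ball x₀ R) f) +
          ENNReal.ofReal (1 / R ^ 2) * D * volume (univ : Set S1)) := by
          rw [lintegral_const_mul' _ _ (ENNReal.mul_ne_top ENNReal.coe_ne_top hS),
            lintegral_add_right _ measurable_const, lintegral_const]
      _ ≤ _ := by
          rw [AddCircle.measure_univ]
          gcongr
  have hc : ENNReal.ofReal (2 / (3 * R)) * ENNReal.ofReal (3 * R / 2) = 1 := by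
    rw [← ENNReal.ofReal_mul (by positivity), ← ENNReal.ofReal_one]
    congr 1
    field_simp
  have hpi := Real.pi_lt_d2
  calc sliceInt (1 / 4) 4 univ f
      = ENNReal.ofReal (2 / (3 * R)) * (ENNReal.ofReal (3 * R / 2) * sliceInt (1 / 4) 4 univ f) := by
        rw [← mul_assoc, hc, one_mul]
    _ ≤ ENNReal.ofReal (2 / (3 * R)) * (A * S * (ENNReal.ofReal (Real.pi * R) * G +
        ENNReal.ofReal (1 / R ^ 2) * D * ENNReal.ofReal (2 * Real.pi))) := by
        exact mul_le_mul_right (hleft.trans hright) _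
    _ = A * S * (ENNReal.ofReal (2 / (3 * R)) * ENNReal.ofReal (Real.pi * R) * G +
        ENNReal.ofReal (2 / (3 * R)) * ENNReal.ofReal (1 / R ^ 2) * ENNReal.ofReal (2 * Real.pi)
          * D) := by ring
    _ ≤ A * S * (5 * G + 5 * ENNReal.ofReal (1 / R ^ 3) * D) := by
        have h5 : (5 : ℝ≥0∞) = ENNReal.ofReal 5 := by simp
        refine mul_le_mul_right (add_le_add (mul_le_mul_left ?_ _) (mul_le_mul_left ?_ _)) _
        · rw [← ENNReal.ofReal_mul (by positivity), h5]
          refine ENNReal.ofReal_le_ofReal ?_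
          calc _ = 2 / 3 * Real.pi := by field_simp
            _ ≤ _ := by linarith
        · rw [← ENNReal.ofReal_mul (by positivity), ← ENNReal.ofReal_mul (by positivity), h5,
            ← ENNReal.ofReal_mul (by positivity)]
          refine ENNReal.ofReal_le_ofReal ?_
          calc _ = 4 / 3 * Real.pi * (1 / R ^ 3) := by field_simp; ring
            _ ≤ _ := by gcongr; linarith
    _ = _ := by
        push_cast
        ring

/-! ### Integration in time. -/

/-- Integration of a slicewise product bound, with one factor bounded uniformly. -/
theorem lintegral_le_of_slice_bound {α : Type*} [MeasurableSpace α] {μ : Measure α}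
    {F a B D : α → ℝ≥0∞} {A c ρ : ℝ≥0∞} (hA0 : A ≠ 0) (hA : A ≠ ⊤) (hρ0 : ρ ≠ 0) (hρ : ρ ≠ ⊤)
    (hD : AEMeasurable D μ) (hF : ∀ᵐ t ∂μ, F t ≤ A * a t * (B t + ρ * D t))
    (haD : ∀ t, a t ≤ D t) (hac : ∀ᵐ t ∂μ, a t ≤ c) :
    ∫⁻ t, F t ∂μ ≤ A * c * ((∫⁻ t, B t ∂μ) + ρ * ∫⁻ t, D t ∂μ) := by
  -- If `c = ⊤`, the right side is `⊤` unless the bracket vanishes. In that case `D = 0` almost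
  -- everywhere, hence `a = 0` and `F = 0`.
  rcases eq_or_ne c ⊤ with rfl | hc
  · rcases eq_or_ne (∫⁻ t, D t ∂μ) 0 with h0 | h0
    · rw [lintegral_eq_zero_iff' hD] at h0
      have : ∫⁻ t, F t ∂μ = ∫⁻ _, 0 ∂μ := by
        refine lintegral_congr_ae ?_
        filter_upwards [h0, hF] with t h1 h2
        have h3 : a t = 0 := le_antisymm ((haD t).trans_eq h1) zero_le
        rw [h3, mul_zero, zero_mul] at h2
        exact le_antisymm h2 zero_le
      rw [this, lintegral_zero]
      exact zero_le
    · rw [ENNReal.mul_top hA0, ENNReal.top_mul]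
      · exact le_top
      · exact fun h => mul_ne_zero hρ0 h0 (add_eq_zero.1 h).2
  · calc ∫⁻ t, F t ∂μ ≤ ∫⁻ t, A * c * (B t + ρ * D t) ∂μ := by
          refine lintegral_mono_ae ?_
          filter_upwards [hF, hac] with t h1 h2
          refine h1.trans ?_
          gcongr
      _ = _ := by
          rw [lintegral_const_mul' _ _ (ENNReal.mul_ne_top hA hc),
            lintegral_add_right' _ (hD.const_mul ρ), lintegral_const_mul' _ _ hρ]

/-- Almost all time slices of `u` have components with `∑ |k|² |û(k)|² < ∞`, and their Fourier
coefficients depend measurably on time. -/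
def HasRegularSlices {n : ℕ} (T : ℝ) (u : ℝ → S1 → EuclideanSpace ℝ (Fin n)) : Prop :=
  (∀ᵐ t ∂(volume.restrict (Icc (0 : ℝ) T)), HasH1Coeffs (u t)) ∧
    ∀ (i : Fin n) (k : ℤ), AEMeasurable (fun t => fourierCoeff (fun y => ((u t y i : ℝ) : ℂ)) k)
      (volume.restrict (Icc (0 : ℝ) T))

theorem HasRegularSlices.aemeasurable_sliceInt {n : ℕ} {T : ℝ}
    {u : ℝ → S1 → EuclideanSpace ℝ (Fin n)} (hu : HasRegularSlices T u) :
    AEMeasurable (fun t => sliceInt (1 / 4) 2 univ (u t)) (volume.restrict (Icc (0 : ℝ) T)) := by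
  have hm : AEMeasurable (fun t => ∑ i, ENNReal.ofReal (2 * Real.pi) * ∑' k : ℤ,
      ‖((√|(k : ℝ)| : ℝ) : ℂ) * fourierCoeff (fun y => ((u t y i : ℝ) : ℂ)) k‖ₑ ^ 2)
      (volume.restrict (Icc (0 : ℝ) T)) :=
    Finset.aemeasurable_fun_sum _ fun i _ => (AEMeasurable.tsum fun k =>
      (((hu.2 i k).const_mul _).enorm.pow_const 2)).const_mul _
  refine hm.congr ?_
  filter_upwards [hu.1] with t ht
  rw [sliceInt_two_eq_sum]
  refine Finset.sum_congr rfl fun i _ => ?_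
  rw [setLIntegral_univ, lintegral_scalarFracLaplacian_sq_eq]
  simp_rw [(ht i).fourierCoeff_quarter]

/-- Both estimates for functions with regular slices, with upper bounds for the local energies
in place of suprema. -/
theorem exists_spaceTimeInt_le : ∃ C : ℝ≥0, 0 < C ∧
    ∀ (n : ℕ) (T : ℝ) (u : ℝ → S1 → EuclideanSpace ℝ (Fin n)), HasRegularSlices T u →
      ∀ (R : ℝ) (c : ℝ≥0∞), 0 < R → R < 1 →
      (∀ x₀ : S1, (∀ᵐ t ∂(volume.restrict (Icc (0 : ℝ) T)),
          sliceInt (1 / 4) 2 (ball x₀ R) (u t) ≤ c) →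
        spaceTimeInt (1 / 4) 4 T (ball x₀ (3 * R / 4)) u ≤ C * c *
          (spaceTimeInt (1 / 2) 2 T (ball x₀ R) u +
            ENNReal.ofReal (1 / R ^ 2) * spaceTimeInt (1 / 4) 2 T univ u)) ∧
      ((∀ᵐ t ∂(volume.restrict (Icc (0 : ℝ) T)),
          ⨆ x : S1, sliceInt (1 / 4) 2 (ball x R) (u t) ≤ c) →
        spaceTimeInt (1 / 4) 4 T univ u ≤ C * c *
          (spaceTimeInt (1 / 2) 2 T univ u +
            ENNReal.ofReal (1 / R ^ 3) * spaceTimeInt (1 / 4) 2 T univ u)) := by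
  obtain ⟨A₁, hA₁, h₁⟩ := exists_sliceInt_ball_le
  obtain ⟨A₂, hA₂, h₂⟩ := exists_sliceInt_univ_le
  refine ⟨A₁ + A₂, by positivity, fun n T u hu R c hR hR1 => ⟨fun x₀ hc => ?_, fun hc => ?_⟩⟩
  · refine lintegral_le_of_slice_bound (a := fun t => sliceInt (1 / 4) 2 (ball x₀ R) (u t))
      (by positivity) ENNReal.coe_ne_top (by positivity) ENNReal.ofReal_ne_top
      hu.aemeasurable_sliceInt ?_ (fun t => lintegral_mono_set (subset_univ _)) hc
    filter_upwards [hu.1] with t ht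
    refine (h₁ n (u t) ht x₀ R hR hR1).trans ?_
    gcongr
    exact le_self_add
  · refine lintegral_le_of_slice_bound
      (a := fun t => ⨆ x : S1, sliceInt (1 / 4) 2 (ball x R) (u t))
      (by positivity) ENNReal.coe_ne_top (by positivity) ENNReal.ofReal_ne_top
      hu.aemeasurable_sliceInt ?_ (fun t => iSup_le fun x => lintegral_mono_set (subset_univ _)) hc
    filter_upwards [hu.1] with t ht
    refine (h₂ n (u t) ht R hR hR1).trans ?_
    gcongr
    exact le_add_self

/-! ### Regular slices of smooth functions. -/

/-- Here `g` plays the derivative of `f`, and its coefficients are square summable by Parseval; the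
weight kills `k = 0`. -/
theorem HasH1Coeff.of_norm_le {f g : S1 → ℂ}
    (hg : MemLp g 2 (AddCircle.haarAddCircle (T := 2 * Real.pi)))
    (h : ∀ k : ℤ, k ≠ 0 → |(k : ℝ)| * ‖fourierCoeff f k‖ ≤ ‖fourierCoeff g k‖) :
    HasH1Coeff f := by
  have hg2 : Memℓp (fun k : ℤ => fourierCoeff g k) 2 := by
    have h1 := lp.memℓp (fourierBasis.repr hg.toLp)
    have h2 : (fun k : ℤ => fourierCoeff g k) = fourierBasis.repr hg.toLp := by
      ext k
      rw [fourierBasis_repr, fourierCoeff_congr_ae hg.coeFn_toLp]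
    rw [h2]
    exact h1
  refine Memℓp.mono' hg2 fun k => ?_
  rcases eq_or_ne k 0 with rfl | hk
  · simp
  · rw [norm_mul, Complex.norm_real, Real.norm_of_nonneg (abs_nonneg _)]
    exact h k hk

/-- A `C¹` function on the circle is regular. -/
theorem HasH1Coeff.of_contDiff {f : S1 → ℂ} (hf : ContDiff ℝ 1 fun y : ℝ => f (y : S1)) :
    HasH1Coeff f := by
  have hper : Function.Periodic (deriv fun y : ℝ => f (y : S1)) (2 * Real.pi) := fun y => by
    rw [← deriv_comp_add_const]
    simp only [AddCircle.coe_add_period]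
  have hcont : Continuous hper.lift :=
    continuous_coinduced_dom.2 (hf.continuous_deriv le_rfl)
  have hd : ∀ y : ℝ, HasDerivAt (fun y : ℝ => f (y : S1)) (hper.lift (y : S1)) y := fun y =>
    ((hf.differentiable one_ne_zero) y).hasDerivAt
  refine HasH1Coeff.of_norm_le
    (hcont.memLp_of_hasCompactSupport (HasCompactSupport.of_compactSpace _)) fun k hk => ?_
  have hk' : 0 < |(k : ℝ)| := abs_pos.2 (by exact_mod_cast hk)
  rw [fourierCoeff_eq_of_hasDerivAt hd hcont hk, norm_mul, norm_inv, norm_mul, Complex.norm_I,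
    one_mul, Complex.norm_intCast, mul_inv_cancel_left₀ hk'.ne']

theorem SmoothOn.contDiff_slice {n : ℕ} {T : ℝ} {u : ℝ → S1 → EuclideanSpace ℝ (Fin n)}
    (hu : SmoothOn (Icc 0 T) u) {t : ℝ} (ht : t ∈ Icc 0 T) (i : Fin n) :
    ContDiff ℝ ∞ fun y : ℝ => ((u t (y : S1) i : ℝ) : ℂ) := by
  have h1 : ContDiff ℝ ∞ fun y : ℝ => u t (y : S1) := by
    rw [← contDiffOn_univ]
    exact ContDiffOn.comp (f := fun y : ℝ => (t, y)) hu
      (contDiff_const.prodMk contDiff_id).contDiffOn fun y _ => ⟨ht, mem_univ _⟩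
  exact Complex.ofRealCLM.contDiff.comp ((EuclideanSpace.proj (𝕜 := ℝ) i).contDiff.comp h1)

theorem SmoothOn.hasRegularSlices {n : ℕ} {T : ℝ} {u : ℝ → S1 → EuclideanSpace ℝ (Fin n)}
    (hu : SmoothOn (Icc 0 T) u) : HasRegularSlices T u := by
  refine ⟨ae_restrict_of_forall_mem measurableSet_Icc fun t ht i =>
    HasH1Coeff.of_contDiff ((hu.contDiff_slice ht i).of_le (by simp)), fun i k => ?_⟩
  simp_rw [fun t => fourierCoeff_eq_intervalIntegral (fun y => ((u t y i : ℝ) : ℂ)) k 0,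
    intervalIntegral.integral_of_le (by linarith [Real.pi_pos] : (0 : ℝ) ≤ 0 + 2 * Real.pi)]
  refine AEMeasurable.const_smul ?_ _
  refine (AEStronglyMeasurable.integral_prod_right' (f := fun p : ℝ × ℝ =>
    (fourier (-k) (p.2 : S1) : ℂ) • ((u p.1 (p.2 : S1) i : ℝ) : ℂ)) ?_).aemeasurable
  rw [Measure.prod_restrict]
  refine ContinuousOn.aestronglyMeasurable ?_ (measurableSet_Icc.prod measurableSet_Ioc)
  have h1 : ContinuousOn (fun p : ℝ × ℝ => u p.1 (p.2 : S1)) (Icc 0 T ×ˢ univ) := hu.continuousOn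
  have h2 : ContinuousOn (fun p : ℝ × ℝ => ((u p.1 (p.2 : S1) i : ℝ) : ℂ)) (Icc 0 T ×ˢ univ) :=
    (Complex.continuous_ofReal.comp (EuclideanSpace.proj (𝕜 := ℝ) i).continuous).comp_continuousOn
      h1
  have h3 : Continuous fun p : ℝ × ℝ => (fourier (-k) (p.2 : S1) : ℂ) :=
    (fourier (-k)).continuous.comp ((AddCircle.continuous_mk' _).comp continuous_snd)
  exact h3.continuousOn.smul (h2.mono (prod_mono_right (subset_univ _)))

/-! ### Regular slices of Sobolev functions. -/

instance isFiniteMeasure_cylinder (T : ℝ) : IsFiniteMeasure (cylinder T) := by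
  unfold cylinder
  infer_instance

theorem isTest_mul {T : ℝ} (hT : 0 < T) {a : ℝ → ℝ} (ha : ContDiff ℝ ∞ a) (hac : HasCompactSupport a)
    (haT : tsupport a ⊆ Ioo 0 T) {c : S1 → ℝ} (hc : ContDiff ℝ ∞ fun y : ℝ => c (y : S1)) :
    IsTest T fun t x => a t * c x := by
  refine ⟨((ha.comp contDiff_fst).mul (hc.comp contDiff_snd)).contDiffOn, ?_⟩
  rcases (tsupport a).eq_empty_or_nonempty with h | h
  · refine ⟨T / 2, T / 2, by linarith, by linarith, fun t _ x => ?_⟩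
    have : a t = 0 := image_eq_zero_of_notMem_tsupport (by rw [h]; exact notMem_empty t)
    simp [this]
  · obtain ⟨p, hp, hp'⟩ := hac.isCompact.exists_isLeast h
    obtain ⟨q, hq, hq'⟩ := hac.isCompact.exists_isGreatest h
    refine ⟨p, q, (haT hp).1, (haT hq).2, fun t ht x => ?_⟩
    have : a t = 0 := image_eq_zero_of_notMem_tsupport fun h => ht ⟨hp' h, hq' h⟩
    simp [this]

/-- The weak spatial derivative on almost every time slice. -/
theorem ae_integral_eq_zero_of_weakDeriv {n : ℕ} {T : ℝ} (hT : 0 < T)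
    {u : ℝ → S1 → EuclideanSpace ℝ (Fin n)} {ux : ℝ × S1 → EuclideanSpace ℝ (Fin n)}
    (hu : Integrable (fun p : ℝ × S1 => u p.1 p.2) (cylinder T)) (hux : Integrable ux (cylinder T))
    (hweak : ∀ φ : ℝ → S1 → ℝ, IsTest T φ →
      ∫ p, spaceDeriv φ p.1 p.2 • u p.1 p.2 ∂cylinder T = -∫ p, φ p.1 p.2 • ux p ∂cylinder T)
    {c c' : S1 → ℝ} (hc : Continuous c) (hc' : Continuous c')
    (hcs : ContDiff ℝ ∞ fun y : ℝ => c (y : S1))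
    (hcc : ∀ x : S1, HasDerivAt (fun h : ℝ => c (x + (h : S1))) (c' x) 0) (i : Fin n) :
    ∀ᵐ t ∂(volume.restrict (Icc (0 : ℝ) T)), ∫ x, (c' x * u t x i + c x * ux (t, x) i) = 0 := by
  have hui : Integrable (fun p : ℝ × S1 => u p.1 p.2 i) (cylinder T) :=
    (EuclideanSpace.proj (𝕜 := ℝ) i).integrable_comp hu
  have huxi : Integrable (fun p : ℝ × S1 => ux p i) (cylinder T) :=
    (EuclideanSpace.proj (𝕜 := ℝ) i).integrable_comp hux
  have hbd : ∀ {d : S1 → ℝ}, Continuous d → ∃ M, ∀ x, ‖d x‖ ≤ M := fun {d} hd => by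
    obtain ⟨M, hM⟩ := isCompact_univ.exists_bound_of_continuousOn hd.continuousOn
    exact ⟨M, fun x => hM x (mem_univ x)⟩
  have hmul : ∀ {d : S1 → ℝ}, Continuous d → ∀ {f : ℝ × S1 → ℝ}, Integrable f (cylinder T) →
      Integrable (fun p : ℝ × S1 => d p.2 * f p) (cylinder T) := fun {d} hd {f} hf => by
    obtain ⟨M, hM⟩ := hbd hd
    exact hf.bdd_mul (hd.comp continuous_snd).aestronglyMeasurable
      (Filter.Eventually.of_forall fun p => hM p.2)
  have hH : Integrable (fun p : ℝ × S1 => c' p.2 * u p.1 p.2 i + c p.2 * ux p i) (cylinder T) :=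
    (hmul hc' hui).add (hmul hc huxi)
  -- Testing with products `a(t) c(x)` for fixed `c` and arbitrary `a`, the fundamental lemma of the
  -- calculus of variations in `t` localizes the weak identity to almost every slice.
  have key := isOpen_Ioo.ae_eq_zero_of_integral_contDiff_smul_eq_zero (U := Ioo 0 T)
    (μ := volume.restrict (Icc (0 : ℝ) T))
    (f := fun t => ∫ x, (c' x * u t x i + c x * ux (t, x) i))
    ((Integrable.integral_prod_left hH).locallyIntegrable.locallyIntegrableOn _) ?_
  · have hIoo : ∀ᵐ t ∂(volume.restrict (Icc (0 : ℝ) T)), t ∈ Ioo 0 T := by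
      rw [← Measure.restrict_congr_set Ioo_ae_eq_Icc]
      exact ae_restrict_mem measurableSet_Ioo
    filter_upwards [key, hIoo] with t h1 h2 using h1 h2
  intro a ha hac haT
  obtain ⟨M, hM⟩ := hac.exists_bound_of_continuous ha.continuous
  have hamul : ∀ {E : Type} [NormedAddCommGroup E] [NormedSpace ℝ E] {f : ℝ × S1 → E},
      Integrable f (cylinder T) → Integrable (fun p : ℝ × S1 => a p.1 • f p) (cylinder T) :=
    fun {E} _ _ {f} hf => hf.bdd_smul M (ha.continuous.comp continuous_fst).aestronglyMeasurable
      (Filter.Eventually.of_forall fun p => hM p.1)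
  have hsmul : ∀ {d : S1 → ℝ}, Continuous d → ∀ {f : ℝ × S1 → EuclideanSpace ℝ (Fin n)},
      Integrable f (cylinder T) → Integrable (fun p : ℝ × S1 => (a p.1 * d p.2) • f p)
        (cylinder T) := fun {d} hd {f} hf => by
    obtain ⟨M', hM'⟩ := hbd hd
    simp_rw [mul_smul]
    exact hamul (hf.bdd_smul M' (hd.comp continuous_snd).aestronglyMeasurable
      (Filter.Eventually.of_forall fun p => hM' p.2))
  have hw := hweak _ (isTest_mul hT ha hac haT hcs)
  have hsd : ∀ p : ℝ × S1, spaceDeriv (fun t x => a t * c x) p.1 p.2 = a p.1 * c' p.2 := fun p =>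
    ((hcc p.2).const_mul (a p.1)).deriv
  simp_rw [hsd] at hw
  have hw' := congrArg (EuclideanSpace.proj (𝕜 := ℝ) i) hw
  rw [map_neg, ← ContinuousLinearMap.integral_comp_comm _ (hsmul hc' hu),
    ← ContinuousLinearMap.integral_comp_comm _ (hsmul hc hux)] at hw'
  have hw2 : (∫ p : ℝ × S1, a p.1 • (c' p.2 * u p.1 p.2 i) ∂cylinder T) =
      -∫ p : ℝ × S1, a p.1 • (c p.2 * ux p i) ∂cylinder T := by
    refine Eq.trans ?_ (hw'.trans ?_)
    · refine integral_congr_ae (Filter.Eventually.of_forall fun p => ?_)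
      simp [mul_assoc]
    · congr 1
      refine integral_congr_ae (Filter.Eventually.of_forall fun p => ?_)
      simp [mul_assoc]
  calc ∫ t in Icc 0 T, a t • ∫ x, (c' x * u t x i + c x * ux (t, x) i)
      = ∫ t in Icc 0 T, ∫ x, a t • (c' x * u t x i + c x * ux (t, x) i) := by
        simp_rw [integral_smul]
    _ = ∫ p : ℝ × S1, a p.1 • (c' p.2 * u p.1 p.2 i + c p.2 * ux p i) ∂cylinder T :=
        (integral_prod _ (hamul hH)).symm
    _ = 0 := by
        simp_rw [smul_add]
        rw [integral_add (hamul (hmul hc' hui)) (hamul (hmul hc huxi)), hw2, neg_add_cancel]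

theorem contDiff_fourier (k : ℤ) : ContDiff ℝ ∞ fun y : ℝ => (fourier k (y : S1) : ℂ) := by
  simp only [fourier_coe_apply]
  have h : ContDiff ℝ ∞ fun y : ℝ => (y : ℂ) := Complex.ofRealCLM.contDiff
  exact ((contDiff_const.mul h).div_const _).cexp

theorem hasDerivAt_fourier_add (k : ℤ) (x : S1) :
    HasDerivAt (fun h : ℝ => (fourier k (x + (h : S1)) : ℂ)) (Complex.I * k * fourier k x) 0 := by
  have h1 := (hasDerivAt_fourier (2 * Real.pi) k 0).const_mul (fourier k x : ℂ)
  have h2 : (fun h : ℝ => (fourier k (x + (h : S1)) : ℂ)) =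
      fun h : ℝ => (fourier k x : ℂ) * fourier k (h : S1) := by
    ext h
    rw [fourier_apply, fourier_apply, fourier_apply, smul_add, AddCircle.toCircle_add,
      Circle.coe_mul]
  rw [h2]
  refine h1.congr_deriv ?_
  have hpi : (Real.pi : ℂ) ≠ 0 := by exact_mod_cast Real.pi_ne_zero
  rw [AddCircle.coe_zero, fourier_eval_zero]
  push_cast
  field_simp

/-- Fourier coefficients of the weak spatial derivative. -/
theorem ae_fourierCoeff_weakDeriv {n : ℕ} {T : ℝ} (hT : 0 < T)
    {u : ℝ → S1 → EuclideanSpace ℝ (Fin n)} {ux : ℝ × S1 → EuclideanSpace ℝ (Fin n)}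
    (hu : Integrable (fun p : ℝ × S1 => u p.1 p.2) (cylinder T)) (hux : Integrable ux (cylinder T))
    (hweak : ∀ φ : ℝ → S1 → ℝ, IsTest T φ →
      ∫ p, spaceDeriv φ p.1 p.2 • u p.1 p.2 ∂cylinder T = -∫ p, φ p.1 p.2 • ux p ∂cylinder T)
    (i : Fin n) (k : ℤ) :
    ∀ᵐ t ∂(volume.restrict (Icc (0 : ℝ) T)), fourierCoeff (fun x => ((ux (t, x) i : ℝ) : ℂ)) k =
      Complex.I * k * fourierCoeff (fun x => ((u t x i : ℝ) : ℂ)) k := by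
  have hF : Continuous fun x : S1 => (fourier k x : ℂ) := (fourier k).continuous
  have hre := ae_integral_eq_zero_of_weakDeriv hT hu hux hweak
    (c := fun x => (fourier k x : ℂ).re) (c' := fun x => (Complex.I * k * fourier k x).re)
    (Complex.continuous_re.comp hF) (Complex.continuous_re.comp (continuous_const.mul hF))
    (Complex.reCLM.contDiff.comp (contDiff_fourier k))
    (fun x => Complex.reCLM.hasFDerivAt.comp_hasDerivAt 0 (hasDerivAt_fourier_add k x)) i
  have him := ae_integral_eq_zero_of_weakDeriv hT hu hux hweak
    (c := fun x => (fourier k x : ℂ).im) (c' := fun x => (Complex.I * k * fourier k x).im)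
    (Complex.continuous_im.comp hF) (Complex.continuous_im.comp (continuous_const.mul hF))
    (Complex.imCLM.contDiff.comp (contDiff_fourier k))
    (fun x => Complex.imCLM.hasFDerivAt.comp_hasDerivAt 0 (hasDerivAt_fourier_add k x)) i
  have hui : Integrable (fun p : ℝ × S1 => u p.1 p.2 i) (cylinder T) :=
    (EuclideanSpace.proj (𝕜 := ℝ) i).integrable_comp hu
  have huxi : Integrable (fun p : ℝ × S1 => ux p i) (cylinder T) :=
    (EuclideanSpace.proj (𝕜 := ℝ) i).integrable_comp hux
  filter_upwards [hre, him, hui.prod_right_ae, huxi.prod_right_ae] with t h1 h2 h3 h4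
  have hmul : ∀ {d : S1 → ℂ}, Continuous d → ∀ {f : S1 → ℝ}, Integrable f →
      Integrable (fun x => d x * ((f x : ℝ) : ℂ)) := fun {d} hd {f} hf => by
    obtain ⟨M, hM⟩ := isCompact_univ.exists_bound_of_continuousOn hd.continuousOn
    exact hf.ofReal.bdd_mul hd.aestronglyMeasurable
      (Filter.Eventually.of_forall fun x => hM x (mem_univ x))
  have hmulr : ∀ {d : S1 → ℝ}, Continuous d → ∀ {f : S1 → ℝ}, Integrable f →
      Integrable (fun x => d x * f x) := fun {d} hd {f} hf => by
    obtain ⟨M, hM⟩ := isCompact_univ.exists_bound_of_continuousOn hd.continuousOn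
    exact hf.bdd_mul hd.aestronglyMeasurable
      (Filter.Eventually.of_forall fun x => hM x (mem_univ x))
  have hFn : Continuous fun x : S1 => (fourier (-k) x : ℂ) := (fourier (-k)).continuous
  have h5 : ∫ x, (fourier (-k) x * ((ux (t, x) i : ℝ) : ℂ) -
      Complex.I * k * (fourier (-k) x * ((u t x i : ℝ) : ℂ))) = 0 := by
    -- Test functions are real, so the identity is known for the real and imaginary parts of
    -- `fourier k`; as `fourier (-k)` is its conjugate, they recombine as `re - i im`.
    have h6 : ∀ x : S1, fourier (-k) x * ((ux (t, x) i : ℝ) : ℂ) -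
        Complex.I * k * (fourier (-k) x * ((u t x i : ℝ) : ℂ)) =
        (((Complex.I * k * fourier k x).re * u t x i + (fourier k x : ℂ).re * ux (t, x) i : ℝ) : ℂ)
        - Complex.I * (((Complex.I * k * fourier k x).im * u t x i +
          (fourier k x : ℂ).im * ux (t, x) i : ℝ) : ℂ) := fun x => by
      rw [fourier_neg]
      apply Complex.ext <;> simp <;> ring
    simp_rw [h6]
    rw [integral_sub, integral_const_mul, integral_complex_ofReal, integral_complex_ofReal, h1, h2]
    · simp
    · exact ((hmulr (Complex.continuous_re.comp (continuous_const.mul hF)) h3).add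
        (hmulr (Complex.continuous_re.comp hF) h4)).ofReal
    · exact ((hmulr (Complex.continuous_im.comp (continuous_const.mul hF)) h3).add
        (hmulr (Complex.continuous_im.comp hF) h4)).ofReal.const_mul _
  rw [integral_sub (hmul hFn h4) ((hmul hFn h3).const_mul _), integral_const_mul, sub_eq_zero] at h5
  simp only [fourierCoeff, AddCircle.integral_haarAddCircle, smul_eq_mul]
  rw [h5, mul_smul_comm]

theorem MemH1.hasRegularSlices {n : ℕ} {T : ℝ} (hT : 0 < T)
    {u : ℝ → S1 → EuclideanSpace ℝ (Fin n)} (hu : MemH1 T u) : HasRegularSlices T u := by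
  obtain ⟨hu2, ut, ux, -, hux2, hweak⟩ := hu
  have huI := hu2.integrable one_le_two
  have huxI := hux2.integrable one_le_two
  constructor
  · have hcoeff : ∀ᵐ t ∂(volume.restrict (Icc (0 : ℝ) T)), ∀ (i : Fin n) (k : ℤ),
        fourierCoeff (fun x => ((ux (t, x) i : ℝ) : ℂ)) k =
          Complex.I * k * fourierCoeff (fun x => ((u t x i : ℝ) : ℂ)) k :=
      -- The exceptional null set depends on the test function, but only countably many characters
      -- are used.
      ae_all_iff.2 fun i => ae_all_iff.2 fun k =>
        ae_fourierCoeff_weakDeriv hT huI huxI (fun φ hφ => (hweak φ hφ).2) i k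
    have hL2 : ∀ᵐ t ∂(volume.restrict (Icc (0 : ℝ) T)), MemLp (fun x => ux (t, x)) 2 := by
      have h1 := ((memLp_two_iff_integrable_sq_norm hux2.1).1 hux2).prod_right_ae
      filter_upwards [h1, AEStronglyMeasurable.prodMk_left hux2.1] with t h2 h3
      exact (memLp_two_iff_integrable_sq_norm h3).2 h2
    filter_upwards [hcoeff, hL2] with t h1 h2 i
    have h3 : MemLp (fun x => ((ux (t, x) i : ℝ) : ℂ)) 2
        (AddCircle.haarAddCircle (T := 2 * Real.pi)) := by
      have h4 : MemLp (fun x => ((ux (t, x) i : ℝ) : ℂ)) 2 (volume : Measure S1) :=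
        ((EuclideanSpace.proj (𝕜 := ℝ) i).comp_memLp' h2).ofReal
      rw [haar_eq_smul_volume]
      exact h4.smul_measure (ENNReal.inv_ne_top.2 (ENNReal.ofReal_pos.2 Real.two_pi_pos).ne')
    refine HasH1Coeff.of_norm_le h3 fun k _ => ?_
    rw [h1 i k, norm_mul, norm_mul, Complex.norm_I, one_mul, Complex.norm_intCast]
  · intro i k
    simp only [fourierCoeff, AddCircle.integral_haarAddCircle]
    refine AEMeasurable.const_smul ?_ _
    refine (AEStronglyMeasurable.integral_prod_right' (f := fun p : ℝ × S1 =>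
      (fourier (-k) p.2 : ℂ) • ((u p.1 p.2 i : ℝ) : ℂ)) ?_).aemeasurable
    refine AEStronglyMeasurable.smul
      ((fourier (-k)).continuous.comp continuous_snd).aestronglyMeasurable ?_
    exact (Complex.continuous_ofReal.comp
      (EuclideanSpace.proj (𝕜 := ℝ) i).continuous).comp_aestronglyMeasurable hu2.1

end HalfHarmonic

end

/-! ### The theorem. -/

theorem mainTheorem12 :
    ∃ C : ℝ≥0, 0 < C ∧
      ∀ (n : ℕ) (T : ℝ), 0 < T → ∀ u : ℝ → S1 → EuclideanSpace ℝ (Fin n),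
        (SmoothOn (Icc 0 T) u → ∀ R : ℝ, 0 < R → R < 1 →
          (∀ x₀ : S1,
            spaceTimeInt (1 / 4) 4 T (ball x₀ (3 * R / 4)) u ≤
              C * (⨆ t ∈ Icc (0 : ℝ) T, sliceInt (1 / 4) 2 (ball x₀ R) (u t)) *
                (spaceTimeInt (1 / 2) 2 T (ball x₀ R) u +
                  ENNReal.ofReal (1 / R ^ 2) * spaceTimeInt (1 / 4) 2 T univ u)) ∧
          spaceTimeInt (1 / 4) 4 T univ u ≤
            C * (⨆ t ∈ Icc (0 : ℝ) T, ⨆ x : S1, sliceInt (1 / 4) 2 (ball x R) (u t)) *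
              (spaceTimeInt (1 / 2) 2 T univ u +
                ENNReal.ofReal (1 / R ^ 3) * spaceTimeInt (1 / 4) 2 T univ u)) ∧
        (MemH1 T u →
          (∃ M : ℝ≥0, ∀ᵐ t ∂(volume.restrict (Icc (0 : ℝ) T)), energy (u t) ≤ M) →
          ∀ R : ℝ, 0 < R → R < 1 →
          (∀ x₀ : S1,
            spaceTimeInt (1 / 4) 4 T (ball x₀ (3 * R / 4)) u ≤
              C * essSup (fun t => sliceInt (1 / 4) 2 (ball x₀ R) (u t))
                  (volume.restrict (Icc (0 : ℝ) T)) *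
                (spaceTimeInt (1 / 2) 2 T (ball x₀ R) u +
                  ENNReal.ofReal (1 / R ^ 2) * spaceTimeInt (1 / 4) 2 T univ u)) ∧
          spaceTimeInt (1 / 4) 4 T univ u ≤
            C * essSup (fun t => ⨆ x : S1, sliceInt (1 / 4) 2 (ball x R) (u t))
                (volume.restrict (Icc (0 : ℝ) T)) *
              (spaceTimeInt (1 / 2) 2 T univ u +
                ENNReal.ofReal (1 / R ^ 3) * spaceTimeInt (1 / 4) 2 T univ u)) := by
  obtain ⟨C, hC, h⟩ := exists_spaceTimeInt_le
  refine ⟨C, hC, fun n T hT u => ⟨fun hu R hR hR1 => ?_, fun hu _ R hR hR1 => ?_⟩⟩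
  · exact ⟨fun x₀ => (h n T u hu.hasRegularSlices R _ hR hR1).1 x₀
        (ae_restrict_of_forall_mem measurableSet_Icc fun t ht =>
          le_iSup₂ (f := fun t _ => sliceInt (1 / 4) 2 (ball x₀ R) (u t)) t ht),
      (h n T u hu.hasRegularSlices R _ hR hR1).2
        (ae_restrict_of_forall_mem measurableSet_Icc fun t ht =>
          le_iSup₂ (f := fun t _ => ⨆ x : S1, sliceInt (1 / 4) 2 (ball x R) (u t)) t ht)⟩
  · exact ⟨fun x₀ => (h n T u (hu.hasRegularSlices hT) R _ hR hR1).1 x₀ (ENNReal.ae_le_essSup _),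
      (h n T u (hu.hasRegularSlices hT) R _ hR hR1).2 (ENNReal.ae_le_essSup _)⟩
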